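/- Let $K\in\mathbb N$ and consider the two-period censored regression model $$Y_\tau=\max\{0,\alpha+\boldsymbol X_\tau^\top\boldsymbol\theta_0+\varepsilon_\tau\},\qquad \tau\in\{1,2\},$$ with regressors $\boldsymbol X_\tau\in\mathbb R^K$, parameter $\boldsymbol\theta_0\in\mathbb R^K$, fixed effect $\alpha$ and errors $\varepsilon_\tau$. Write $\Delta\boldsymbol X=\boldsymbol X_1-\boldsymbol X_2$, $\boldsymbol Y=(Y_1,Y_2)$, $\boldsymbol W=(\boldsymbol X_1,\boldsymbol X_2,\alpha)$. The trimmed square loss is, for $t\in\mathbb R$ and $\boldsymbol y\in[0,\infty)^2$, $$m(t,\boldsymbol y)=\frac12\begin{cases}y_1^2-2(y_2+t)y_1,&t\le -y_2,\\(y_1-y_2-t)^2,&-y_2<t<y_1,\\y_2^2+2(t-y_1)y_2,&t\ge y_1,\end{cases} \qquad \dot m_1(t,\boldsymbol y)=\frac{\partial m}{\partial t}(t,\boldsymbol y)=\begin{cases}-y_1,&t\le -y_2,\\y_2-y_1+t,&-y_2<t<y_1,\\y_2,&t\ge y_1.\end{cases}$$ Let $\boldsymbol Z_i=(Y_{i1},\boldsymbol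 X_{i1},Y_{i2},\boldsymbol X_{i2})$, $i=1,2,\dots$, be i.i.d. with the distribution of $(Y_1,\boldsymbol X_1,Y_2,\boldsymbol X_2)$, and for each $n\ge1$ let $\widehat{\boldsymbol\theta}_n$ be any minimizer over $\boldsymbol\theta\in\mathbb R^K$ of $\frac1n\sum_{i=1}^n m(\Delta\boldsymbol X_i^\top\boldsymbol\theta,\boldsymbol Y_i)$ (the TLS estimator). Assume: 1. $\mathbb P(Y_1>0,Y_2>0)>0$. 2. $\mathrm E\|\boldsymbol X_1\|_2^4$, $\mathrm E\|\boldsymbol X_2\|_2^4$, $\mathrm E[\alpha^2\|\Delta\boldsymbol X\|_2^4]$, $\mathrm E[\varepsilon_1^2\|\Delta\boldsymbol X\|_2^4]$, $\mathrm E[\varepsilon_2^2\|\Delta\boldsymbol X\|_2^4]$ are finite. 3. The conditional distribution of $(\varepsilon_1,\varepsilon_2)$ given $\boldsymbol W$ is absolutely continuous with respect to Lebesgue measure on $\mathbb R^2$. 4. Conditional on $\boldsymbol W$, $\varepsilon_1$ and $\varepsilon_2$ are exchangeable. 5. No proper linear subspace of $\mathbb R^K$ contains $\mathbf 1\{\mathbb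 P(Y_1>0,Y_2>0\mid\boldsymbol X_1,\boldsymbol X_2)>0\}\,\Delta\boldsymbol X$ with probability one. 6. No proper linear subspace of $\mathbb R^K$ contains $\big(\mathbf 1\{Y_1>0\}\mathbf 1\{\Delta\boldsymbol X^\top\boldsymbol\theta_0\le0\}+\mathbf 1\{Y_2>0\}\mathbf 1\{\Delta\boldsymbol X^\top\boldsymbol\theta_0>0\}\big)\Delta\boldsymbol X$ with probability one. 7. The expectations defining $\mathbf V_0:=\mathrm E[\dot m_1(\Delta\boldsymbol X^\top\boldsymbol\theta_0,\boldsymbol Y)^2\,\Delta\boldsymbol X\Delta\boldsymbol X^\top]$ exist in $\mathbb R^{K\times K}$, and $\mathbf V_0$ has full rank. Then $\boldsymbol G(\boldsymbol\theta):=\mathrm E[\dot m_1(\Delta\boldsymbol X^\top\boldsymbol\theta,\boldsymbol Y)\Delta\boldsymbol X]$ is well defined on $\mathbb R^K$ and differentiable at $\boldsymbol\theta_0$; let $\mathbf J_0:=\nabla\boldsymbol G(\boldsymbol\theta_0)$ be its Jacobian. Put $$\widehat{\mathbf V}_n=\frac1n\sum_{i=1}^n\dot m_1(\Delta\boldsymbol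 X_i^\top\widehat{\boldsymbol\theta}_n,\boldsymbol Y_i)^2\,\Delta\boldsymbol X_i\Delta\boldsymbol X_i^\top,$$ $$\widehat{\mathbf J}_n=\frac1n\sum_{i=1}^n\Big(\mathbf 1\{Y_{i1}>0\}\big(\mathbf 1\{\Delta\boldsymbol X_i^\top\widehat{\boldsymbol\theta}_n<0\}+\tfrac12\mathbf 1\{\Delta\boldsymbol X_i^\top\widehat{\boldsymbol\theta}_n=0\}\big)+\mathbf 1\{Y_{i2}>0\}\big(\mathbf 1\{\Delta\boldsymbol X_i^\top\widehat{\boldsymbol\theta}_n>0\}+\tfrac12\mathbf 1\{\Delta\boldsymbol X_i^\top\widehat{\boldsymbol\theta}_n=0\}\big)\Big)\Delta\boldsymbol X_i\Delta\boldsymbol X_i^\top.$$ Almost surely, as $n\to\infty$, $\widehat{\mathbf V}_n\to\mathbf V_0$ and $\widehat{\mathbf J}_n\to\mathbf J_0$. Consequently, $\mathbf J_0$ is invertible, almost surely $\widehat{\mathbf J}_n$ is invertible for all sufficiently large $n$, and $$\widehat{\mathbf J}_n^{-1}\widehat{\mathbf V}_n\widehat{\mathbf J}_n^{-1}\to\mathbf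 J_0^{-1}\mathbf V_0\mathbf J_0^{-1}\quad\text{almost surely.}$$ -/

import Mathlib

open MeasureTheory ProbabilityTheory Filter Topology

/-- Coefficient / regressor space `ℝ^K` with the Euclidean norm. -/
abbrev RVec (K : ℕ) : Type := EuclideanSpace ℝ (Fin K)

/-- The indicator `𝟏{p}` of a logical statement. -/
def ind (p : Prop) [Decidable p] : ℝ := if p then 1 else 0

/-- The outer product `v vᵀ`. -/
def outer {K : ℕ} (v : RVec K) : Matrix (Fin K) (Fin K) ℝ := Matrix.of fun j k => v j * v k

/-! ### The trimmed square loss and its derivative -/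

/-- The trimmed square loss `m(t, (y₁, y₂))`. -/
noncomputable def tlsLoss (t y₁ y₂ : ℝ) : ℝ :=
  (1 / 2) *
    (if t ≤ -y₂ then y₁ ^ 2 - 2 * (y₂ + t) * y₁
     else if t < y₁ then (y₁ - y₂ - t) ^ 2
     else y₂ ^ 2 + 2 * (t - y₁) * y₂)

/-- The partial derivative of the trimmed square loss in its first argument
(see `hasDerivAt_tlsLoss`). -/
noncomputable def tlsScore (t y₁ y₂ : ℝ) : ℝ :=
  if t ≤ -y₂ then -y₁
  else if t < y₁ then y₂ - y₁ + t
  else y₂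

theorem hasDerivAt_max_zero_sq (x : ℝ) :
    HasDerivAt (fun s : ℝ => max 0 s ^ 2) (2 * max 0 x) x := by
  rcases lt_trichotomy x 0 with h | h | h
  · have : (fun s : ℝ => max 0 s ^ 2) =ᶠ[𝓝 x] fun _ => 0 := by
      filter_upwards [gt_mem_nhds h] with s hs
      simp [max_eq_left hs.le]
    simpa [max_eq_left h.le] using (hasDerivAt_const x (0 : ℝ)).congr_of_eventuallyEq this
  · subst h
    rw [hasDerivAt_iff_isLittleO]
    simp only [max_self, sub_zero, mul_zero, smul_zero]
    have h1 : (fun s : ℝ => max 0 s ^ 2 - 0 ^ 2) =O[𝓝 0] fun s : ℝ => s ^ 2 := by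
      refine Asymptotics.IsBigO.of_bound 1 (Eventually.of_forall fun s => ?_)
      rcases le_total s 0 with hs | hs
      · simp [max_eq_left hs, sq_nonneg]
      · simp [max_eq_right hs]
    exact h1.trans_isLittleO (Asymptotics.isLittleO_pow_id one_lt_two)
  · have : (fun s : ℝ => max 0 s ^ 2) =ᶠ[𝓝 x] fun s => s ^ 2 := by
      filter_upwards [lt_mem_nhds h] with s hs
      simp [max_eq_right hs.le]
    simpa [max_eq_right h.le] using (hasDerivAt_pow 2 x).congr_of_eventuallyEq this

/-- On the domain `y₁, y₂ ≥ 0`, `tlsScore` is the derivative of `tlsLoss` in the first argument. -/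
theorem hasDerivAt_tlsLoss (t : ℝ) {y₁ y₂ : ℝ} (h₁ : 0 ≤ y₁) (h₂ : 0 ≤ y₂) :
    HasDerivAt (fun s => tlsLoss s y₁ y₂) (tlsScore t y₁ y₂) t := by
  have e : (fun s => tlsLoss s y₁ y₂) = fun s =>
      (1 / 2) * ((y₁ - y₂ - s) ^ 2 - max 0 (-y₂ - s) ^ 2 - max 0 (s - y₁) ^ 2) := by
    funext s
    unfold tlsLoss
    split_ifs with ha hb
    · rw [max_eq_right (by linarith), max_eq_left (by linarith)]; ring
    · rw [max_eq_left (by linarith), max_eq_left (by linarith)]; ring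
    · rw [max_eq_left (by linarith), max_eq_right (by linarith)]; ring
  rw [e]
  have d1 : HasDerivAt (fun s : ℝ => (y₁ - y₂ - s) ^ 2) (2 * (y₁ - y₂ - t) * (-1)) t := by
    have h := (hasDerivAt_pow 2 (y₁ - y₂ - t)).comp t ((hasDerivAt_id t).const_sub (y₁ - y₂))
    simpa [Function.comp_def] using h
  have d2 : HasDerivAt (fun s : ℝ => max 0 (-y₂ - s) ^ 2) (2 * max 0 (-y₂ - t) * (-1)) t :=
    HasDerivAt.comp (h₂ := fun s : ℝ => max 0 s ^ 2) t (hasDerivAt_max_zero_sq (-y₂ - t))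
      ((hasDerivAt_id t).const_sub (-y₂))
  have d3 : HasDerivAt (fun s : ℝ => max 0 (s - y₁) ^ 2) (2 * max 0 (t - y₁) * 1) t :=
    HasDerivAt.comp (h₂ := fun s : ℝ => max 0 s ^ 2) t (hasDerivAt_max_zero_sq (t - y₁))
      ((hasDerivAt_id t).sub_const y₁)
  refine (((d1.sub d2).sub d3).const_mul (1 / 2)).congr_deriv ?_
  unfold tlsScore
  split_ifs with ha hb
  · rw [max_eq_right (by linarith), max_eq_left (by linarith)]; ring
  · rw [max_eq_left (by linarith), max_eq_left (by linarith)]; ring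
  · rw [max_eq_left (by linarith), max_eq_right (by linarith)]; ring

/-! ### Observations and sample quantities -/

/-- An observation `(y₁, x₁, y₂, x₂)`: outcome and regressors in the two periods. -/
abbrev PanelObs (K : ℕ) : Type := ℝ × RVec K × ℝ × RVec K

namespace PanelObs

variable {K : ℕ}

/-- First-period outcome. -/
def y₁ (z : PanelObs K) : ℝ := z.1

/-- Second-period outcome. -/
def y₂ (z : PanelObs K) : ℝ := z.2.2.1

/-- The regressor difference `Δx = x₁ - x₂`. -/
def dx (z : PanelObs K) : RVec K := z.2.1 - z.2.2.2

/-- The index `Δxᵀ θ`. -/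
noncomputable def index (z : PanelObs K) (θ : RVec K) : ℝ := inner ℝ (dx z) θ

/-- The loss `m(Δxᵀ θ, y)`. -/
noncomputable def loss (z : PanelObs K) (θ : RVec K) : ℝ := tlsLoss (index z θ) (y₁ z) (y₂ z)

/-- The derivative `ṁ₁(Δxᵀ θ, y)`. -/
noncomputable def score (z : PanelObs K) (θ : RVec K) : ℝ := tlsScore (index z θ) (y₁ z) (y₂ z)

/-- The midpoint indicator weight
`𝟏{y₁ > 0} (𝟏{Δxᵀθ < 0} + ½ 𝟏{Δxᵀθ = 0}) + 𝟏{y₂ > 0} (𝟏{Δxᵀθ > 0} + ½ 𝟏{Δxᵀθ = 0})`. -/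
noncomputable def midWeight (z : PanelObs K) (θ : RVec K) : ℝ :=
  ind (0 < y₁ z) * (ind (index z θ < 0) + (1 / 2) * ind (index z θ = 0)) +
  ind (0 < y₂ z) * (ind (0 < index z θ) + (1 / 2) * ind (index z θ = 0))

end PanelObs

/-- The TLS sample criterion `θ ↦ n⁻¹ ∑_{i<n} m(Δxᵢᵀ θ, yᵢ)`. -/
noncomputable def tlsCriterion {K : ℕ} (z : ℕ → PanelObs K) (n : ℕ) (θ : RVec K) : ℝ :=
  (n : ℝ)⁻¹ * ∑ i ∈ Finset.range n, (z i).loss θ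

/-- The plug-in estimator `n⁻¹ ∑_{i<n} ṁ₁(Δxᵢᵀ θ, yᵢ)² Δxᵢ Δxᵢᵀ`, to be evaluated at `θ = θ̂`. -/
noncomputable def tlsVHat {K : ℕ} (z : ℕ → PanelObs K) (n : ℕ) (θ : RVec K) :
    Matrix (Fin K) (Fin K) ℝ :=
  (n : ℝ)⁻¹ • ∑ i ∈ Finset.range n, ((z i).score θ) ^ 2 • outer (z i).dx

/-- The plug-in Hessian estimator with midpoint indicators, to be evaluated at `θ = θ̂`. -/
noncomputable def tlsJHat {K : ℕ} (z : ℕ → PanelObs K) (n : ℕ) (θ : RVec K) :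
    Matrix (Fin K) (Fin K) ℝ :=
  (n : ℝ)⁻¹ • ∑ i ∈ Finset.range n, ((z i).midWeight θ) • outer (z i).dx

/-! ### The two-period censored regression model with fixed effects -/

/-- The primitives of the model: regressors, fixed effect, errors and the true parameter. -/
structure CensoredPanel (K : ℕ) (Ω : Type*) [MeasurableSpace Ω] where
  /-- First-period regressors. -/
  X₁ : Ω → RVec K
  /-- Second-period regressors. -/
  X₂ : Ω → RVec K
  /-- The fixed effect. -/
  α : Ω → ℝ
  /-- First-period error. -/
  ε₁ : Ω → ℝ
  /-- Second-period error. -/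
  ε₂ : Ω → ℝ
  /-- The true parameter. -/
  θ₀ : RVec K
  measurable_X₁ : Measurable X₁
  measurable_X₂ : Measurable X₂
  measurable_α : Measurable α
  measurable_ε₁ : Measurable ε₁
  measurable_ε₂ : Measurable ε₂

namespace CensoredPanel

variable {K : ℕ} {Ω : Type*} [mΩ : MeasurableSpace Ω] (M : CensoredPanel K Ω) (P : Measure Ω)

/-- First-period outcome `Y₁ = max {0, α + X₁ᵀ θ₀ + ε₁}`. -/
noncomputable def Y₁ (ω : Ω) : ℝ := max 0 (M.α ω + inner ℝ (M.X₁ ω) M.θ₀ + M.ε₁ ω)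

/-- Second-period outcome `Y₂ = max {0, α + X₂ᵀ θ₀ + ε₂}`. -/
noncomputable def Y₂ (ω : Ω) : ℝ := max 0 (M.α ω + inner ℝ (M.X₂ ω) M.θ₀ + M.ε₂ ω)

/-- The observable `(Y₁, X₁, Y₂, X₂)`. -/
noncomputable def obs (ω : Ω) : PanelObs K := (M.Y₁ ω, M.X₁ ω, M.Y₂ ω, M.X₂ ω)

/-- The regressor difference `ΔX = X₁ - X₂`. -/
def dX (ω : Ω) : RVec K := M.X₁ ω - M.X₂ ω

/-- The conditioning variables `W = (X₁, X₂, α)`. -/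
def W (ω : Ω) : RVec K × RVec K × ℝ := (M.X₁ ω, M.X₂ ω, M.α ω)

/-- The error pair `ε = (ε₁, ε₂)`. -/
def ε (ω : Ω) : ℝ × ℝ := (M.ε₁ ω, M.ε₂ ω)

/-- Non-degeneracy: `P(Y₁ > 0, Y₂ > 0) > 0`. -/
def NonDegenerate : Prop := 0 < P {ω | 0 < M.Y₁ ω ∧ 0 < M.Y₂ ω}

/-- Integrability conditions. -/
def MomentConditions : Prop :=
  Integrable (fun ω => ‖M.X₁ ω‖ ^ 4) P ∧
  Integrable (fun ω => ‖M.X₂ ω‖ ^ 4) P ∧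
  Integrable (fun ω => M.α ω ^ 2 * ‖M.dX ω‖ ^ 4) P ∧
  Integrable (fun ω => M.ε₁ ω ^ 2 * ‖M.dX ω‖ ^ 4) P ∧
  Integrable (fun ω => M.ε₂ ω ^ 2 * ‖M.dX ω‖ ^ 4) P

/-- The conditional distribution of `(ε₁, ε₂)` given `W` is absolutely continuous with respect to
Lebesgue measure on the plane. -/
def ContinuousErrors [IsFiniteMeasure P] : Prop :=
  ∀ᵐ w ∂(P.map M.W), condDistrib M.ε M.W P w ≪ (volume : Measure (ℝ × ℝ))

/-- Conditional on `W`, the errors `ε₁` and `ε₂` are exchangeable. -/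
def ExchangeableErrors [IsFiniteMeasure P] : Prop :=
  ∀ᵐ w ∂(P.map M.W), (condDistrib M.ε M.W P w).map Prod.swap = condDistrib M.ε M.W P w

/-- A version of the conditional probability `P(Y₁ > 0, Y₂ > 0 | X₁, X₂)`. -/
noncomputable def condProbBothPos : Ω → ℝ :=
  P[Set.indicator {ω | 0 < M.Y₁ ω ∧ 0 < M.Y₂ ω} (fun _ => (1 : ℝ)) |
    MeasurableSpace.comap (fun ω => (M.X₁ ω, M.X₂ ω)) inferInstance]

/-- Rank of regressors: no proper linear subspace contains
`𝟏{P(Y₁ > 0, Y₂ > 0 | X₁, X₂) > 0} ΔX` with probability one. -/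
def RankRegressors : Prop :=
  ∀ S : Submodule ℝ (RVec K),
    (∀ᵐ ω ∂P, ind (0 < M.condProbBothPos P ω) • M.dX ω ∈ S) → S = ⊤

/-- Score Jacobian invertibility condition: no proper linear subspace contains
`(𝟏{Y₁ > 0} 𝟏{ΔXᵀθ₀ ≤ 0} + 𝟏{Y₂ > 0} 𝟏{ΔXᵀθ₀ > 0}) ΔX` with probability one. -/
def JacobianRank : Prop :=
  ∀ S : Submodule ℝ (RVec K),
    (∀ᵐ ω ∂P, (ind (0 < M.Y₁ ω) * ind (inner ℝ (M.dX ω) M.θ₀ ≤ 0) +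
      ind (0 < M.Y₂ ω) * ind (0 < inner ℝ (M.dX ω) M.θ₀)) • M.dX ω ∈ S) → S = ⊤

/-- The expectations defining `V₀` exist and are finite. -/
def VExists : Prop :=
  ∀ j k : Fin K,
    Integrable (fun ω => ((M.obs ω).score M.θ₀) ^ 2 * outer (M.dX ω) j k) P

/-- The matrix `V₀ = E[ṁ₁(ΔXᵀθ₀, Y)² ΔX ΔXᵀ]`. -/
noncomputable def V₀ : Matrix (Fin K) (Fin K) ℝ :=
  Matrix.of fun j k => ∫ ω, ((M.obs ω).score M.θ₀) ^ 2 * outer (M.dX ω) j k ∂P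

/-- The expected score `G(θ) = E[ṁ₁(ΔXᵀθ, Y) ΔX]`. -/
noncomputable def G (θ : RVec K) : RVec K := ∫ ω, (M.obs ω).score θ • M.dX ω ∂P

/-- The Jacobian matrix `J₀ = ∇G(θ₀)`, with entries `∂G_j/∂θ_k (θ₀)`. -/
noncomputable def J₀ : Matrix (Fin K) (Fin K) ℝ :=
  Matrix.of fun j k => (fderiv ℝ (M.G P) M.θ₀ (EuclideanSpace.single k 1)) j

end CensoredPanel

/-- `Z₀, Z₁, …` is a random sample from the distribution of the observable of the model. -/
def IsRandomSample {K : ℕ} {Ω Ω' : Type*} [MeasurableSpace Ω] [MeasurableSpace Ω']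
    (M : CensoredPanel K Ω) (P : Measure Ω) (Z : ℕ → Ω' → PanelObs K) (Q : Measure Ω') : Prop :=
  iIndepFun Z Q ∧ ∀ i, IdentDistrib (Z i) M.obs Q P

/-- `θhat n` is a TLS estimator based on the first `n` observations, for every `n ≥ 1`: almost
surely, it is a global minimizer of the sample criterion. -/
def IsTLSEstimator {K : ℕ} {Ω' : Type*} [MeasurableSpace Ω']
    (Z : ℕ → Ω' → PanelObs K) (Q : Measure Ω') (θhat : ℕ → Ω' → RVec K) : Prop :=
  ∀ᵐ ω ∂Q, ∀ n : ℕ, 1 ≤ n →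
    ∀ θ : RVec K, tlsCriterion (fun i => Z i ω) n (θhat n ω) ≤ tlsCriterion (fun i => Z i ω) n θ

/-! ### Scalar facts about the trimmed square loss -/

/-! The loss is convex and continuously differentiable in `t`; its derivative is a clamp of `y₂ - y₁
+ t`, hence 1-Lipschitz with local slopes 0 and 1. Everything else rests on exchangeability: two
functions of the observation whose sums over the two orderings of the errors agree have equal
expectations (`integral_obs_eq_of_symm`).

Swapping the errors changes the sign of the score at `θ₀`, so the expected score vanishes there. It
also identifies, in expectation against functions of the regressors, three weights: the true local
slope `slopeWeight`, which at index zero depends on the direction of approach; the weight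
`midWeight` of the Hessian estimator; and `leftWeight`, the one in the rank condition. The first
identification turns a direction-dependent slope into a linear map, so `G` is differentiable at `θ₀`
with Jacobian E[`midWeight` ΔX ΔXᵀ]; absolute continuity of the errors removes the remaining kinks
(`hasFDerivAt_G`). The second transfers the rank condition to this matrix, which is therefore
positive definite (`eq_zero_of_integral_midWeight`).

The same definiteness makes `θ₀` the unique population minimizer (`integral_loss_sub_pos`). A law of
large numbers on small spheres around `θ₀`, together with convexity of the sample criterion, then
confines the minimizers (`ae_tendsto_estimator`).

The outer-product estimator converges because the score is Lipschitz and the bounding moments are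
finite. The Hessian estimator is discontinuous in `θ`, so a uniform law of large numbers over
half-spaces is used (`ae_uniform_average_halfspace`), by bracketing and without assuming that
hyperplanes are null. Its population limit is continuous at `θ₀` even if ΔXᵀθ₀ = 0 has positive
probability: on that event the symmetrized `midWeight` does not depend on `θ`
(`tendsto_integral_midWeight`). All almost sure events are uniform in `θ` or involve only
`θ₀`-averages, so measurability of the estimator plays no role. -/

theorem tlsScore_eq (t : ℝ) {y₁ y₂ : ℝ} (h₁ : 0 ≤ y₁) (h₂ : 0 ≤ y₂) :
    tlsScore t y₁ y₂ = max (-y₁) (min y₂ (y₂ - y₁ + t)) := by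
  unfold tlsScore
  split_ifs with ha hb
  · rw [min_eq_right (by linarith), max_eq_left (by linarith)]
  · rw [min_eq_right (by linarith), max_eq_right (by linarith)]
  · rw [min_eq_left (by linarith), max_eq_right (by linarith)]

/-- Clamping to an interval is nonexpansive. -/
theorem abs_tlsScore_sub_le (t s : ℝ) {y₁ y₂ : ℝ} (h₁ : 0 ≤ y₁) (h₂ : 0 ≤ y₂) :
    |tlsScore t y₁ y₂ - tlsScore s y₁ y₂| ≤ |t - s| := by
  rw [tlsScore_eq t h₁ h₂, tlsScore_eq s h₁ h₂, max_comm, max_comm (-y₁)]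
  refine (abs_max_sub_max_le_abs _ _ _).trans ?_
  rw [min_comm, min_comm y₂]
  refine (abs_min_sub_min_le_max _ _ _ _).trans ?_
  simp [add_sub_add_left_eq_sub]

/-- The loss lies above its tangents. -/
theorem tlsLoss_tangent_le (t s : ℝ) {y₁ y₂ : ℝ} (h₁ : 0 ≤ y₁) (h₂ : 0 ≤ y₂) :
    tlsLoss s y₁ y₂ + tlsScore s y₁ y₂ * (t - s) ≤ tlsLoss t y₁ y₂ := by
  unfold tlsLoss tlsScore
  split_ifs <;> nlinarith [sq_nonneg (t - s), sq_nonneg (t + y₂), sq_nonneg (t - y₁),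
    sq_nonneg (s + y₂), sq_nonneg (s - y₁)]

/-- Immediately to the right of such an `s` the loss is a parabola of curvature one, so it leaves
its tangent at once and convexity keeps it above. The next lemma is the mirror image. -/
theorem tlsLoss_tangent_lt_of_lt {t s y₁ y₂ : ℝ} (hs : -y₂ ≤ s) (hs' : s < y₁)
    (hst : s < t) :
    tlsLoss s y₁ y₂ + tlsScore s y₁ y₂ * (t - s) < tlsLoss t y₁ y₂ := by
  have e1 : tlsLoss s y₁ y₂ = (1 / 2) * (y₁ - y₂ - s) ^ 2 := by
    unfold tlsLoss
    split_ifs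
    · obtain rfl : s = -y₂ := by linarith
      ring
    · rfl
  have e2 : tlsScore s y₁ y₂ = y₂ - y₁ + s := by
    unfold tlsScore
    split_ifs
    · linarith
    · rfl
  rw [e1, e2]
  unfold tlsLoss
  rw [if_neg (by linarith)]
  split_ifs with h
  · nlinarith [mul_pos (sub_pos.2 hst) (sub_pos.2 hst)]
  · nlinarith [mul_pos (sub_pos.2 hs') (sub_pos.2 hs'),
      mul_nonneg (sub_pos.2 hs').le (sub_nonneg.2 (not_lt.1 h))]

theorem tlsLoss_tangent_lt_of_gt {t s y₁ y₂ : ℝ} (h₁ : 0 ≤ y₁) (hs : -y₂ < s) (hs' : s ≤ y₁)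
    (hst : t < s) :
    tlsLoss s y₁ y₂ + tlsScore s y₁ y₂ * (t - s) < tlsLoss t y₁ y₂ := by
  have e1 : tlsLoss s y₁ y₂ = (1 / 2) * (y₁ - y₂ - s) ^ 2 := by
    unfold tlsLoss
    rw [if_neg (by linarith)]
    split_ifs
    · rfl
    · obtain rfl : s = y₁ := by linarith
      ring
  have e2 : tlsScore s y₁ y₂ = y₂ - y₁ + s := by
    unfold tlsScore
    rw [if_neg (by linarith)]
    split_ifs
    · rfl
    · linarith
  rw [e1, e2]
  unfold tlsLoss
  split_ifs with h h'
  · nlinarith [mul_pos (show 0 < s + y₂ by linarith) (show 0 < s + y₂ by linarith),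
      mul_nonneg (show 0 ≤ s + y₂ by linarith) (show 0 ≤ -y₂ - t by linarith)]
  · nlinarith [mul_pos (sub_pos.2 hst) (sub_pos.2 hst)]
  · linarith

/-- The tangents at both points bound the difference from either side, and the score at either point
is within its distance to `u` of the score at `u`. The anchor `u` will be the index at `θ₀`, where
score moments are available. -/
theorem abs_tlsLoss_sub_le (t s u : ℝ) {y₁ y₂ : ℝ} (h₁ : 0 ≤ y₁) (h₂ : 0 ≤ y₂) :
    |tlsLoss t y₁ y₂ - tlsLoss s y₁ y₂| ≤
      |t - s| * (|tlsScore u y₁ y₂| + max |t - u| |s - u|) := by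
  have key : ∀ v, |tlsScore v y₁ y₂| ≤ |tlsScore u y₁ y₂| + |v - u| := fun v => by
    have := abs_tlsScore_sub_le v u h₁ h₂
    have h3 := abs_sub_abs_le_abs_sub (tlsScore v y₁ y₂) (tlsScore u y₁ y₂)
    linarith
  have a := tlsLoss_tangent_le t s h₁ h₂
  have b := tlsLoss_tangent_le s t h₁ h₂
  have ha : |tlsScore s y₁ y₂ * (t - s)| ≤
      |t - s| * (|tlsScore u y₁ y₂| + max |t - u| |s - u|) := by
    rw [abs_mul, mul_comm]
    gcongr
    exact (key s).trans (by gcongr; exact le_max_right _ _)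
  have hb : |tlsScore t y₁ y₂ * (s - t)| ≤
      |t - s| * (|tlsScore u y₁ y₂| + max |t - u| |s - u|) := by
    rw [abs_mul, mul_comm, abs_sub_comm s t]
    gcongr
    exact (key t).trans (by gcongr; exact le_max_left _ _)
  rw [abs_le] at *
  constructor <;> linarith [ha.1, hb.1]

/-- In the weighted sum of the tangent inequality at the intermediate point, evaluated at both ends,
the slope terms cancel. -/
theorem tlsLoss_convex (t s : ℝ) {l y₁ y₂ : ℝ} (h₁ : 0 ≤ y₁) (h₂ : 0 ≤ y₂) (hl : 0 ≤ l)
    (hl' : l ≤ 1) :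
    tlsLoss (s + l * (t - s)) y₁ y₂ ≤ (1 - l) * tlsLoss s y₁ y₂ + l * tlsLoss t y₁ y₂ := by
  have a := mul_le_mul_of_nonneg_left (tlsLoss_tangent_le t (s + l * (t - s)) h₁ h₂) hl
  have b := mul_le_mul_of_nonneg_left (tlsLoss_tangent_le s (s + l * (t - s)) h₁ h₂)
    (sub_nonneg.2 hl')
  nlinarith

/-! ### Uniform law of large numbers over half-spaces -/

/-- Half-spaces through the origin, intersected with a subspace, have finite bracketing numbers
with respect to every finite measure. -/
theorem exists_finite_halfspace_brackets {E : Type*} [NormedAddCommGroup E]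
    [InnerProductSpace ℝ E] [FiniteDimensional ℝ E] [MeasurableSpace E] [BorelSpace E]
    (μ : Measure E) [IsFiniteMeasure μ] (n : ℕ) :
    ∀ S : Submodule ℝ E, Module.finrank ℝ S ≤ n → ∀ ε : ENNReal, 0 < ε →
      ∃ B : Set (Set E × Set E), B.Finite ∧
        (∀ p ∈ B, MeasurableSet p.1 ∧ MeasurableSet p.2 ∧ μ (p.2 \ p.1) ≤ ε) ∧
        ∀ u : E, ∃ p ∈ B, p.1 ⊆ {x | x ∈ S ∧ 0 < inner ℝ x u} ∧
          {x | x ∈ S ∧ 0 < inner ℝ x u} ⊆ p.2 := by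
  induction n with
  | zero =>
    intro S hS ε hε
    obtain rfl : S = ⊥ := by rwa [← Submodule.finrank_eq_zero (R := ℝ), ← Nat.le_zero]
    refine ⟨{(∅, ∅)}, Set.finite_singleton _, by simp, fun u => ⟨(∅, ∅), rfl, by simp, ?_⟩⟩
    rintro x ⟨hx, hxu⟩
    rw [Submodule.mem_bot] at hx
    simp [hx] at hxu
  | succ n ih =>
    intro S hS ε hε
    have hSm : MeasurableSet (S : Set E) := S.closed_of_finiteDimensional.measurableSet
    have hinner : ∀ u : E, Measurable fun x : E => (inner ℝ x u : ℝ) := fun u =>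
      (by fun_prop : Continuous fun x : E => (inner ℝ x u : ℝ)).measurable
    have local_brackets : ∀ u₀ ∈ S, ‖u₀‖ = 1 → ∃ δ > 0, ∃ B : Set (Set E × Set E), B.Finite ∧
        (∀ p ∈ B, MeasurableSet p.1 ∧ MeasurableSet p.2 ∧ μ (p.2 \ p.1) ≤ ε) ∧
        ∀ u : E, ‖u - u₀‖ ≤ δ → ∃ p ∈ B, p.1 ⊆ {x | x ∈ S ∧ 0 < inner ℝ x u} ∧
          {x | x ∈ S ∧ 0 < inner ℝ x u} ⊆ p.2 := by
      intro u₀ hu₀ hn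
      -- A punctured cone around the hyperplane orthogonal to `u₀`. Leaving out the hyperplane
      -- itself makes these cones shrink to the empty set, whatever mass the hyperplane carries.
      set D : ℝ → Set E := fun δ => {x | 0 < |(inner ℝ x u₀ : ℝ)| ∧ |(inner ℝ x u₀ : ℝ)| ≤ δ * ‖x‖}
        with hD
      have hDm : ∀ δ, MeasurableSet (D δ) := fun δ =>
        (measurableSet_lt measurable_const (hinner u₀).abs).inter
          (measurableSet_le (hinner u₀).abs (measurable_norm.const_mul δ))
      obtain ⟨δ, hδ, hδμ⟩ : ∃ δ > 0, μ (D δ) ≤ ε / 2 := by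
        have hanti : Antitone fun k : ℕ => D (1 / ((k : ℝ) + 1)) := by
          intro k l hkl x hx
          exact ⟨hx.1, hx.2.trans (by gcongr)⟩
        have hlim := tendsto_measure_iInter_atTop (μ := μ)
          (fun k : ℕ => (hDm (1 / ((k : ℝ) + 1))).nullMeasurableSet) hanti
          ⟨0, measure_ne_top _ _⟩
        have hempty : ⋂ k : ℕ, D (1 / ((k : ℝ) + 1)) = ∅ := by
          refine Set.eq_empty_iff_forall_notMem.2 fun x hx => ?_
          rw [Set.mem_iInter] at hx
          have h0 : Tendsto (fun k : ℕ => 1 / ((k : ℝ) + 1) * ‖x‖) atTop (𝓝 (0 * ‖x‖)) :=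
            tendsto_one_div_add_atTop_nhds_zero_nat.mul_const _
          have := ge_of_tendsto' h0 fun k => (hx k).2
          linarith [(hx 0).1]
        rw [hempty, measure_empty] at hlim
        obtain ⟨k, hk⟩ := (hlim.eventually_le_const (ENNReal.half_pos hε.ne')).exists
        exact ⟨_, Nat.one_div_pos_of_nat, hk⟩
      -- The omitted hyperplane section has smaller dimension, so the induction hypothesis brackets
      -- the half-spaces inside it.
      set T : Submodule ℝ E := S ⊓ (ℝ ∙ u₀)ᗮ with hT
      have hmemT : ∀ x, x ∈ T ↔ x ∈ S ∧ inner ℝ x u₀ = 0 := fun x => by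
        rw [hT, Submodule.mem_inf, Submodule.mem_orthogonal_singleton_iff_inner_left]
      have hTS : T < S := by
        refine lt_of_le_of_ne inf_le_left fun h => ?_
        have h1 : u₀ ∈ T := h ▸ hu₀
        have h2 := ((hmemT _).1 h1).2
        rw [real_inner_self_eq_norm_sq, hn] at h2
        norm_num at h2
      obtain ⟨B, hBf, hB, hBu⟩ := ih T
        (Nat.le_of_lt_succ ((Submodule.finrank_lt_finrank_of_lt hTS).trans_le hS)) (ε / 2)
        (ENNReal.half_pos hε.ne')
      -- The points whose inner product with `u` is positive for every `u` within `δ` of `u₀`; they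
      -- enter both the lower and the upper bracket.
      set A : Set E := {x | x ∈ S ∧ δ * ‖x‖ < inner ℝ x u₀} with hA
      have hAm : MeasurableSet A :=
        hSm.inter (measurableSet_lt (measurable_norm.const_mul δ) (hinner u₀))
      refine ⟨δ, hδ, (fun p => (p.1 ∪ A, p.2 ∪ D δ ∪ A)) '' B, hBf.image _, ?_, ?_⟩
      · rintro _ ⟨p, hp, rfl⟩
        obtain ⟨hp1, hp2, hp3⟩ := hB p hp
        refine ⟨hp1.union hAm, (hp2.union (hDm δ)).union hAm, ?_⟩
        have hsub : (p.2 ∪ D δ ∪ A) \ (p.1 ∪ A) ⊆ (p.2 \ p.1) ∪ D δ := by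
          rintro x ⟨(hx | hx) | hx, hx'⟩
          · exact Or.inl ⟨hx, fun h => hx' (Or.inl h)⟩
          · exact Or.inr hx
          · exact absurd (Or.inr hx) hx'
        calc μ ((p.2 ∪ D δ ∪ A) \ (p.1 ∪ A)) ≤ μ ((p.2 \ p.1) ∪ D δ) := measure_mono hsub
          _ ≤ μ (p.2 \ p.1) + μ (D δ) := measure_union_le _ _
          _ ≤ ε / 2 + ε / 2 := add_le_add hp3 hδμ
          _ = ε := ENNReal.add_halves ε
      · intro u hu
        have hclose : ∀ x : E, |(inner ℝ x u : ℝ) - inner ℝ x u₀| ≤ δ * ‖x‖ := fun x => by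
          rw [← inner_sub_right]
          refine (abs_real_inner_le_norm _ _).trans ?_
          rw [mul_comm]
          gcongr
        obtain ⟨p, hp, hpl, hph⟩ := hBu u
        refine ⟨_, ⟨p, hp, rfl⟩, ?_, ?_⟩
        · rintro x (hx | hx)
          · exact ⟨((hmemT x).1 (hpl hx).1).1, (hpl hx).2⟩
          · refine ⟨hx.1, ?_⟩
            have h1 := (abs_le.1 (hclose x)).1
            have h2 : δ * ‖x‖ < inner ℝ x u₀ := hx.2
            linarith
        · rintro x ⟨hxS, hxu⟩
          by_cases h0 : (inner ℝ x u₀ : ℝ) = 0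
          · exact Or.inl (Or.inl (hph ⟨(hmemT x).2 ⟨hxS, h0⟩, hxu⟩))
          by_cases h1 : |(inner ℝ x u₀ : ℝ)| ≤ δ * ‖x‖
          · exact Or.inl (Or.inr ⟨abs_pos.2 h0, h1⟩)
          · refine Or.inr ⟨hxS, ?_⟩
            rcases lt_abs.1 (not_le.1 h1) with h | h
            · exact h
            · have := (abs_le.1 (hclose x)).2
              linarith
    have hcomp : IsCompact (Metric.sphere (0 : E) 1 ∩ S) :=
      (isCompact_sphere (0 : E) 1).inter_right S.closed_of_finiteDimensional
    obtain ⟨B, hBf, hB, hBu⟩ : ∃ B : Set (Set E × Set E), B.Finite ∧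
        (∀ p ∈ B, MeasurableSet p.1 ∧ MeasurableSet p.2 ∧ μ (p.2 \ p.1) ≤ ε) ∧
        ∀ u ∈ Metric.sphere (0 : E) 1 ∩ S, ∃ p ∈ B, p.1 ⊆ {x | x ∈ S ∧ 0 < inner ℝ x u} ∧
          {x | x ∈ S ∧ 0 < inner ℝ x u} ⊆ p.2 := by
      refine hcomp.induction_on (p := fun s => ∃ B : Set (Set E × Set E), B.Finite ∧
        (∀ p ∈ B, MeasurableSet p.1 ∧ MeasurableSet p.2 ∧ μ (p.2 \ p.1) ≤ ε) ∧
        ∀ u ∈ s, ∃ p ∈ B, p.1 ⊆ {x | x ∈ S ∧ 0 < inner ℝ x u} ∧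
          {x | x ∈ S ∧ 0 < inner ℝ x u} ⊆ p.2) ?_ ?_ ?_ ?_
      · exact ⟨∅, Set.finite_empty, by simp, by simp⟩
      · rintro s t hst ⟨B, h1, h2, h3⟩
        exact ⟨B, h1, h2, fun u hu => h3 u (hst hu)⟩
      · rintro s t ⟨B, h1, h2, h3⟩ ⟨C, k1, k2, k3⟩
        refine ⟨B ∪ C, h1.union k1, ?_, ?_⟩
        · rintro p (hp | hp)
          exacts [h2 p hp, k2 p hp]
        · rintro u (hu | hu)
          · obtain ⟨p, hp, h⟩ := h3 u hu
            exact ⟨p, Or.inl hp, h⟩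
          · obtain ⟨p, hp, h⟩ := k3 u hu
            exact ⟨p, Or.inr hp, h⟩
      · rintro u₀ ⟨hu₀, hu₀S⟩
        obtain ⟨δ, hδ, B, h1, h2, h3⟩ := local_brackets u₀ hu₀S (by simpa using hu₀)
        exact ⟨Metric.closedBall u₀ δ, mem_nhdsWithin_of_mem_nhds (Metric.closedBall_mem_nhds _ hδ),
          B, h1, h2, fun u hu => h3 u (by simpa [dist_eq_norm] using hu)⟩
    refine ⟨insert (∅, ∅) B, hBf.insert _, ?_, fun u => ?_⟩
    · rintro p (rfl | hp)
      · simp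
      · exact hB p hp
    -- Inside `S` only the projection of `u` matters, and only its direction. Zero projection gives
    -- the empty set, which is why the pair `(∅, ∅)` was added to the brackets.
    set v : E := S.starProjection u with hv
    have hvS : v ∈ S := S.starProjection_apply_mem u
    have hxv : ∀ x ∈ S, (inner ℝ x u : ℝ) = inner ℝ x v := fun x hx => by
      have := S.starProjection_inner_eq_zero u x hx
      rw [inner_sub_left, sub_eq_zero] at this
      rw [real_inner_comm, this, real_inner_comm]
    by_cases h0 : v = 0
    · refine ⟨(∅, ∅), Or.inl rfl, by simp, ?_⟩
      rintro x ⟨hx, hxu⟩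
      rw [hxv x hx, h0, inner_zero_right] at hxu
      exact absurd hxu (lt_irrefl _)
    · have hpos : 0 < ‖v‖ := norm_pos_iff.2 h0
      obtain ⟨p, hp, h1⟩ := hBu (‖v‖⁻¹ • v) ⟨by simp [norm_smul, hpos.ne'], S.smul_mem _ hvS⟩
      have hset : {x | x ∈ S ∧ 0 < (inner ℝ x (‖v‖⁻¹ • v) : ℝ)} =
          {x | x ∈ S ∧ 0 < (inner ℝ x u : ℝ)} := by
        ext x
        refine and_congr_right fun hx => ?_
        rw [inner_smul_right, hxv x hx, mul_pos_iff_of_pos_left (inv_pos.2 hpos)]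
      rw [hset] at h1
      exact ⟨p, Or.inr hp, h1⟩

/-- The strong law of large numbers for a function of a random sample. -/
theorem ae_tendsto_average {Ω Ω' 𝒵 : Type*} [MeasurableSpace Ω] [MeasurableSpace Ω']
    [MeasurableSpace 𝒵] {P : Measure Ω} {Q : Measure Ω'} {X : Ω → 𝒵} {Z : ℕ → Ω' → 𝒵}
    (hind : iIndepFun Z Q) (hid : ∀ i, IdentDistrib (Z i) X Q P) {f : 𝒵 → ℝ} (hf : Measurable f)
    (hint : Integrable (fun ω => f (X ω)) P) :
    ∀ᵐ ω ∂Q, Tendsto (fun n : ℕ => (n : ℝ)⁻¹ * ∑ i ∈ Finset.range n, f (Z i ω)) atTop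
      (𝓝 (∫ ω, f (X ω) ∂P)) := by
  have hid' : ∀ i, IdentDistrib (fun ω => f (Z i ω)) (fun ω => f (X ω)) Q P := fun i =>
    (hid i).comp hf
  have h := strong_law_ae_real (μ := Q) (fun i ω => f (Z i ω)) ((hid' 0).integrable_iff.2 hint)
    (fun i j hij => (hind.indepFun hij).comp hf hf) (fun i => (hid' i).trans (hid' 0).symm)
  rw [(hid' 0).integral_eq] at h
  filter_upwards [h] with ω hω
  simpa [div_eq_inv_mul] using hω

section

variable {Ω Ω' 𝒵 E : Type*} [MeasurableSpace Ω] [MeasurableSpace Ω'] [MeasurableSpace 𝒵]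
  [NormedAddCommGroup E] [InnerProductSpace ℝ E] [FiniteDimensional ℝ E] [MeasurableSpace E]
  [BorelSpace E] {P : Measure Ω} {Q : Measure Ω'} {X : Ω → 𝒵} {Z : ℕ → Ω' → 𝒵}

theorem ae_uniform_average_halfspace_of_nonneg
    (hind : iIndepFun Z Q) (hid : ∀ i, IdentDistrib (Z i) X Q P) (hX : Measurable X)
    {a : 𝒵 → ℝ} (ha : Measurable a) (ha0 : ∀ z, 0 ≤ a z)
    (hint : Integrable (fun ω => a (X ω)) P) {d : 𝒵 → E} (hd : Measurable d) {ε : ℝ}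
    (hε : 0 < ε) :
    ∀ᵐ ω ∂Q, ∀ᶠ n : ℕ in atTop, ∀ u : E,
      |(n : ℝ)⁻¹ * ∑ i ∈ Finset.range n,
          Set.indicator {z | 0 < (inner ℝ (d z) u : ℝ)} a (Z i ω) -
        ∫ ω, Set.indicator {z | 0 < (inner ℝ (d z) u : ℝ)} a (X ω) ∂P| ≤ ε := by
  -- With `a` as density, the measure of a bracket gap is exactly the gap between the two bracketing
  -- expectations.
  set ν : Measure Ω := P.withDensity fun ω => ENNReal.ofReal (a (X ω)) with hν
  have : IsFiniteMeasure ν := isFiniteMeasure_withDensity_ofReal hint.2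
  have hdX : Measurable fun ω => d (X ω) := hd.comp hX
  have hbr : ∃ B : Set (Set E × Set E), B.Finite ∧
      (∀ p ∈ B, MeasurableSet p.1 ∧ MeasurableSet p.2 ∧
        (ν.map fun ω => d (X ω)) (p.2 \ p.1) ≤ ENNReal.ofReal (ε / 2)) ∧
      ∀ u : E, ∃ p ∈ B, p.1 ⊆ {x | x ∈ (⊤ : Submodule ℝ E) ∧ 0 < inner ℝ x u} ∧
        {x | x ∈ (⊤ : Submodule ℝ E) ∧ 0 < inner ℝ x u} ⊆ p.2 :=
    exists_finite_halfspace_brackets (ν.map fun ω => d (X ω)) _ ⊤ le_rfl _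
      (ENNReal.ofReal_pos.2 (half_pos hε))
  obtain ⟨B, hBf, hB, hBu⟩ := hbr
  have hintA : ∀ A : Set E, MeasurableSet A →
      Integrable (fun ω => Set.indicator (d ⁻¹' A) a (X ω)) P := fun A hA => by
    have : (fun ω => Set.indicator (d ⁻¹' A) a (X ω)) =
        Set.indicator ((fun ω => d (X ω)) ⁻¹' A) (fun ω => a (X ω)) := rfl
    rw [this]
    exact hint.indicator (hdX hA)
  have hlln : ∀ᵐ ω ∂Q, ∀ p ∈ B,
      Tendsto (fun n : ℕ => (n : ℝ)⁻¹ * ∑ i ∈ Finset.range n,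
        Set.indicator (d ⁻¹' p.1) a (Z i ω)) atTop
          (𝓝 (∫ ω, Set.indicator (d ⁻¹' p.1) a (X ω) ∂P)) ∧
      Tendsto (fun n : ℕ => (n : ℝ)⁻¹ * ∑ i ∈ Finset.range n,
        Set.indicator (d ⁻¹' p.2) a (Z i ω)) atTop
          (𝓝 (∫ ω, Set.indicator (d ⁻¹' p.2) a (X ω) ∂P)) := by
    rw [ae_ball_iff hBf.countable]
    intro p hp
    obtain ⟨h1, h2, -⟩ := hB p hp
    exact (ae_tendsto_average hind hid (ha.indicator (hd h1)) (hintA _ h1)).and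
      (ae_tendsto_average hind hid (ha.indicator (hd h2)) (hintA _ h2))
  filter_upwards [hlln] with ω hω
  have hev : ∀ᶠ n : ℕ in atTop, ∀ p ∈ B,
      (∫ ω, Set.indicator (d ⁻¹' p.1) a (X ω) ∂P) - ε / 2 < (n : ℝ)⁻¹ * ∑ i ∈ Finset.range n,
        Set.indicator (d ⁻¹' p.1) a (Z i ω) ∧
      (n : ℝ)⁻¹ * ∑ i ∈ Finset.range n, Set.indicator (d ⁻¹' p.2) a (Z i ω) <
        (∫ ω, Set.indicator (d ⁻¹' p.2) a (X ω) ∂P) + ε / 2 := by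
    rw [eventually_all_finite hBf]
    intro p hp
    exact ((hω p hp).1.eventually_const_lt (by linarith)).and
      ((hω p hp).2.eventually_lt_const (by linarith))
  filter_upwards [hev] with n hn u
  obtain ⟨p, hp, hpl, hph⟩ := hBu u
  obtain ⟨h1, h2, h3⟩ := hB p hp
  obtain ⟨hn1, hn2⟩ := hn p hp
  have hgap : (∫ ω, Set.indicator (d ⁻¹' p.2) a (X ω) ∂P) -
      ∫ ω, Set.indicator (d ⁻¹' p.1) a (X ω) ∂P ≤ ε / 2 := by
    rw [← integral_sub (hintA _ h2) (hintA _ h1)]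
    have hle : ∫ ω, (Set.indicator (d ⁻¹' p.2) a (X ω) - Set.indicator (d ⁻¹' p.1) a (X ω)) ∂P ≤
        ∫ ω, Set.indicator (d ⁻¹' (p.2 \ p.1)) a (X ω) ∂P := by
      refine integral_mono ((hintA _ h2).sub (hintA _ h1)) (hintA _ (h2.diff h1)) fun ω => ?_
      have := ha0 (X ω)
      by_cases k1 : d (X ω) ∈ p.1 <;> by_cases k2 : d (X ω) ∈ p.2 <;>
        simp [Set.indicator, k1, k2, this]
    refine hle.trans ?_
    have hmeas : MeasurableSet ((fun ω => d (X ω)) ⁻¹' (p.2 \ p.1)) := hdX (h2.diff h1)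
    rw [Measure.map_apply hdX (h2.diff h1), hν, withDensity_apply _ hmeas] at h3
    have heq : ∫ ω, Set.indicator (d ⁻¹' (p.2 \ p.1)) a (X ω) ∂P =
        ∫ ω in (fun ω => d (X ω)) ⁻¹' (p.2 \ p.1), a (X ω) ∂P := by
      rw [← integral_indicator hmeas]
      rfl
    rw [heq, integral_eq_lintegral_of_nonneg_ae (Eventually.of_forall fun ω => ha0 _)
      hint.aestronglyMeasurable.restrict]
    exact ENNReal.toReal_le_of_le_ofReal (half_pos hε).le h3
  have hl' : d ⁻¹' p.1 ⊆ {z | 0 < (inner ℝ (d z) u : ℝ)} := fun z hz => (hpl hz).2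
  have hh' : {z | 0 < (inner ℝ (d z) u : ℝ)} ⊆ d ⁻¹' p.2 := fun z hz => hph ⟨trivial, hz⟩
  have hum : MeasurableSet {x : E | 0 < (inner ℝ x u : ℝ)} :=
    measurableSet_lt measurable_const
      (by fun_prop : Continuous fun x : E => (inner ℝ x u : ℝ)).measurable
  have hi := hintA _ hum
  have s1 : (n : ℝ)⁻¹ * ∑ i ∈ Finset.range n, Set.indicator (d ⁻¹' p.1) a (Z i ω) ≤
      (n : ℝ)⁻¹ * ∑ i ∈ Finset.range n,
          Set.indicator {z | 0 < (inner ℝ (d z) u : ℝ)} a (Z i ω) := by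
    refine mul_le_mul_of_nonneg_left (Finset.sum_le_sum fun i _ => ?_) (by positivity)
    exact Set.indicator_le_indicator_of_subset hl' ha0 _
  have s2 : (n : ℝ)⁻¹ * ∑ i ∈ Finset.range n,
          Set.indicator {z | 0 < (inner ℝ (d z) u : ℝ)} a (Z i ω) ≤
      (n : ℝ)⁻¹ * ∑ i ∈ Finset.range n, Set.indicator (d ⁻¹' p.2) a (Z i ω) := by
    refine mul_le_mul_of_nonneg_left (Finset.sum_le_sum fun i _ => ?_) (by positivity)
    exact Set.indicator_le_indicator_of_subset hh' ha0 _
  have s3 : ∫ ω, Set.indicator (d ⁻¹' p.1) a (X ω) ∂P ≤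
      ∫ ω, Set.indicator {z | 0 < (inner ℝ (d z) u : ℝ)} a (X ω) ∂P :=
    integral_mono (hintA _ h1) hi fun ω => Set.indicator_le_indicator_of_subset hl' ha0 _
  have s4 : ∫ ω, Set.indicator {z | 0 < (inner ℝ (d z) u : ℝ)} a (X ω) ∂P ≤
      ∫ ω, Set.indicator (d ⁻¹' p.2) a (X ω) ∂P :=
    integral_mono hi (hintA _ h2) fun ω => Set.indicator_le_indicator_of_subset hh' ha0 _
  rw [abs_le]
  constructor <;> linarith

/-- Uniform strong law of large numbers for an integrable function restricted to half-spaces. -/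
theorem ae_uniform_average_halfspace
    (hind : iIndepFun Z Q) (hid : ∀ i, IdentDistrib (Z i) X Q P) (hX : Measurable X)
    {a : 𝒵 → ℝ} (ha : Measurable a)
    (hint : Integrable (fun ω => a (X ω)) P) {d : 𝒵 → E} (hd : Measurable d) {ε : ℝ}
    (hε : 0 < ε) :
    ∀ᵐ ω ∂Q, ∀ᶠ n : ℕ in atTop, ∀ u : E,
      |(n : ℝ)⁻¹ * ∑ i ∈ Finset.range n,
          Set.indicator {z | 0 < (inner ℝ (d z) u : ℝ)} a (Z i ω) -
        ∫ ω, Set.indicator {z | 0 < (inner ℝ (d z) u : ℝ)} a (X ω) ∂P| ≤ ε := by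
  -- Bracketing needs averages monotone in the set, hence the split into positive and negative
  -- parts, each with half the tolerance.
  have hp := ae_uniform_average_halfspace_of_nonneg hind hid hX (a := fun z => max (a z) 0)
    (ha.max measurable_const) (fun z => le_max_right _ _) hint.pos_part hd (half_pos hε)
  have hm := ae_uniform_average_halfspace_of_nonneg hind hid hX (a := fun z => max (-a z) 0)
    (ha.neg.max measurable_const) (fun z => le_max_right _ _) hint.neg_part hd (half_pos hε)
  have hum : ∀ u : E, MeasurableSet ((fun ω => d (X ω)) ⁻¹' {x : E | 0 < (inner ℝ x u : ℝ)}) :=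
    fun u => (hd.comp hX) (measurableSet_lt measurable_const
      (by fun_prop : Continuous fun x : E => (inner ℝ x u : ℝ)).measurable)
  filter_upwards [hp, hm] with ω hω hω'
  filter_upwards [hω, hω'] with n hn hn' u
  have hsplit : ∀ z, Set.indicator {z | 0 < (inner ℝ (d z) u : ℝ)} a z =
      Set.indicator {z | 0 < (inner ℝ (d z) u : ℝ)} (fun z => max (a z) 0) z -
      Set.indicator {z | 0 < (inner ℝ (d z) u : ℝ)} (fun z => max (-a z) 0) z := fun z => by
    by_cases h : z ∈ {z | 0 < (inner ℝ (d z) u : ℝ)}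
    · rw [Set.indicator_of_mem h, Set.indicator_of_mem h, Set.indicator_of_mem h]
      rcases le_total (a z) 0 with h' | h'
      · rw [max_eq_right h', max_eq_left (by linarith)]; ring
      · rw [max_eq_left h', max_eq_right (by linarith)]; ring
    · rw [Set.indicator_of_notMem h, Set.indicator_of_notMem h, Set.indicator_of_notMem h, sub_zero]
  have i1 : Integrable (fun ω => Set.indicator {z | 0 < (inner ℝ (d z) u : ℝ)}
      (fun z => max (a z) 0) (X ω)) P := hint.pos_part.indicator (hum u)
  have i2 : Integrable (fun ω => Set.indicator {z | 0 < (inner ℝ (d z) u : ℝ)}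
      (fun z => max (-a z) 0) (X ω)) P := hint.neg_part.indicator (hum u)
  simp only [hsplit]
  rw [integral_sub i1 i2, Finset.sum_sub_distrib, mul_sub]
  have k1 := abs_le.1 (hn u)
  have k2 := abs_le.1 (hn' u)
  rw [abs_le]
  constructor <;> linarith [k1.1, k1.2, k2.1, k2.2]

end

/-! ### Weights and measurability of functions of an observation -/

theorem ind_nonneg (p : Prop) [Decidable p] : 0 ≤ ind p := by unfold ind; split_ifs <;> simp

theorem ind_le_one (p : Prop) [Decidable p] : ind p ≤ 1 := by unfold ind; split_ifs <;> simp

theorem Measurable.ind {β : Type*} [MeasurableSpace β] {p : β → Prop} [∀ b, Decidable (p b)]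
    (h : MeasurableSet {b | p b}) : Measurable fun b => ind (p b) :=
  Measurable.ite h measurable_const measurable_const

namespace PanelObs

variable {K : ℕ}

/-- The slope of the score between `θ₀` and a nearby `θ`. -/
noncomputable def slopeWeight (z : PanelObs K) (θ₀ θ : RVec K) : ℝ :=
  if 0 < index z θ₀ then ind (index z θ₀ < y₁ z)
  else if index z θ₀ < 0 then ind (-y₂ z < index z θ₀)
  else if 0 < index z θ then ind (0 < y₁ z) else ind (0 < y₂ z)

/-- The weight of the Jacobian rank condition. -/
noncomputable def leftWeight (z : PanelObs K) (θ : RVec K) : ℝ :=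
  ind (0 < y₁ z) * ind (index z θ ≤ 0) + ind (0 < y₂ z) * ind (0 < index z θ)

theorem measurable_y₁ : Measurable (y₁ : PanelObs K → ℝ) := measurable_fst

theorem measurable_y₂ : Measurable (y₂ : PanelObs K → ℝ) := measurable_snd.snd.fst

theorem measurable_dx : Measurable (dx : PanelObs K → RVec K) :=
  measurable_snd.fst.sub measurable_snd.snd.snd

theorem measurable_index (θ : RVec K) : Measurable fun z : PanelObs K => index z θ :=
  measurable_dx.inner_const

theorem measurable_score (θ : RVec K) : Measurable fun z : PanelObs K => score z θ := by
  unfold score tlsScore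
  have h1 := measurable_y₁ (K := K)
  have h2 := measurable_y₂ (K := K)
  have h3 := measurable_index (K := K) θ
  exact Measurable.ite (measurableSet_le h3 h2.neg) h1.neg
    (Measurable.ite (measurableSet_lt h3 h1) ((h2.sub h1).add h3) h2)

theorem measurable_loss (θ : RVec K) : Measurable fun z : PanelObs K => loss z θ := by
  unfold loss tlsLoss
  have h1 := measurable_y₁ (K := K)
  have h2 := measurable_y₂ (K := K)
  have h3 := measurable_index (K := K) θ
  exact (Measurable.ite (measurableSet_le h3 h2.neg) (by fun_prop)
    (Measurable.ite (measurableSet_lt h3 h1) (by fun_prop) (by fun_prop))).const_mul _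

theorem measurable_midWeight (θ : RVec K) : Measurable fun z : PanelObs K => midWeight z θ := by
  have h1 := measurable_y₁ (K := K)
  have h2 := measurable_y₂ (K := K)
  have h3 := measurable_index (K := K) θ
  have m1 := Measurable.ind (measurableSet_lt (measurable_const (a := (0 : ℝ))) h1)
  have m2 := Measurable.ind (measurableSet_lt (measurable_const (a := (0 : ℝ))) h2)
  have m3 := Measurable.ind (measurableSet_lt (measurable_const (a := (0 : ℝ))) h3)
  have m4 := Measurable.ind (measurableSet_lt h3 (measurable_const (a := (0 : ℝ))))
  have m5 := Measurable.ind (measurableSet_eq_fun h3 (measurable_const (a := (0 : ℝ))))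
  exact (m1.mul (m4.add (m5.const_mul _))).add (m2.mul (m3.add (m5.const_mul _)))

theorem measurable_leftWeight (θ : RVec K) : Measurable fun z : PanelObs K => leftWeight z θ := by
  have h1 := measurable_y₁ (K := K)
  have h2 := measurable_y₂ (K := K)
  have h3 := measurable_index (K := K) θ
  have m1 := Measurable.ind (measurableSet_lt (measurable_const (a := (0 : ℝ))) h1)
  have m2 := Measurable.ind (measurableSet_lt (measurable_const (a := (0 : ℝ))) h2)
  have m3 := Measurable.ind (measurableSet_lt (measurable_const (a := (0 : ℝ))) h3)
  have m4 := Measurable.ind (measurableSet_le h3 (measurable_const (a := (0 : ℝ))))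
  exact (m1.mul m4).add (m2.mul m3)

theorem measurable_slopeWeight (θ₀ θ : RVec K) :
    Measurable fun z : PanelObs K => slopeWeight z θ₀ θ := by
  have h1 := measurable_y₁ (K := K)
  have h2 := measurable_y₂ (K := K)
  have h3 := measurable_index (K := K) θ
  have h0 := measurable_index (K := K) θ₀
  have c0 : Measurable fun _ : PanelObs K => (0 : ℝ) := measurable_const
  exact Measurable.ite (measurableSet_lt c0 h0) (Measurable.ind (measurableSet_lt h0 h1))
    (Measurable.ite (measurableSet_lt h0 c0) (Measurable.ind (measurableSet_lt h2.neg h0))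
      (Measurable.ite (measurableSet_lt c0 h3) (Measurable.ind (measurableSet_lt c0 h1))
        (Measurable.ind (measurableSet_lt c0 h2))))

theorem slopeWeight_nonneg (z : PanelObs K) (θ₀ θ : RVec K) : 0 ≤ slopeWeight z θ₀ θ := by
  unfold slopeWeight
  split_ifs <;> exact ind_nonneg _

theorem slopeWeight_le_one (z : PanelObs K) (θ₀ θ : RVec K) : slopeWeight z θ₀ θ ≤ 1 := by
  unfold slopeWeight
  split_ifs <;> exact ind_le_one _

theorem midWeight_mem (z : PanelObs K) (θ : RVec K) : 0 ≤ midWeight z θ ∧ midWeight z θ ≤ 1 := by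
  rcases lt_trichotomy (index z θ) 0 with h | h | h <;> unfold midWeight ind <;>
    split_ifs <;> first | linarith | norm_num

theorem leftWeight_mem (z : PanelObs K) (θ : RVec K) :
    0 ≤ leftWeight z θ ∧ leftWeight z θ ≤ 1 := by
  unfold leftWeight ind
  split_ifs <;> first | linarith | norm_num

theorem index_sub (z : PanelObs K) (θ θ' : RVec K) :
    index z θ - index z θ' = inner ℝ (dx z) (θ - θ') := (inner_sub_right _ _ _).symm

theorem abs_index_sub_le (z : PanelObs K) (θ θ' : RVec K) :
    |index z θ - index z θ'| ≤ ‖dx z‖ * ‖θ - θ'‖ := by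
  rw [index_sub]
  exact abs_real_inner_le_norm _ _

theorem abs_score_sub_le {z : PanelObs K} (h₁ : 0 ≤ y₁ z) (h₂ : 0 ≤ y₂ z) (θ θ' : RVec K) :
    |score z θ - score z θ'| ≤ ‖dx z‖ * ‖θ - θ'‖ :=
  (abs_tlsScore_sub_le _ _ h₁ h₂).trans (abs_index_sub_le z θ θ')

/-- A nonzero slope weight says that the move from `θ₀` to `θ` starts into the quadratic piece of
the loss, where convexity is strict. -/
theorem loss_tangent_lt {z : PanelObs K} (h₁ : 0 ≤ y₁ z) (h₂ : 0 ≤ y₂ z) {θ₀ θ : RVec K}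
    (hw : slopeWeight z θ₀ θ ≠ 0) (hne : index z θ ≠ index z θ₀) :
    loss z θ₀ + score z θ₀ * (index z θ - index z θ₀) < loss z θ := by
  unfold slopeWeight ind at hw
  unfold loss score
  rcases lt_or_gt_of_ne hne with h | h
  · refine tlsLoss_tangent_lt_of_gt h₁ ?_ ?_ h <;> split_ifs at hw <;>
      first | exact absurd rfl hw | linarith
  · refine tlsLoss_tangent_lt_of_lt ?_ ?_ h <;> split_ifs at hw <;>
      first | exact absurd rfl hw | linarith

/-- Away from a kink the score is affine near the index. At index zero a kink occurs when an outcome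
is censored, and the direction-dependent branch of `slopeWeight` records the one-sided slope there.
-/
theorem eventually_score_sub_eq {z : PanelObs K} (h₁ : 0 ≤ y₁ z) (h₂ : 0 ≤ y₂ z) {θ₀ : RVec K}
    (hk₁ : 0 < index z θ₀ → y₁ z ≠ index z θ₀) (hk₂ : index z θ₀ < 0 → y₂ z ≠ -index z θ₀) :
    ∀ᶠ θ in 𝓝 θ₀, score z θ - score z θ₀ =
      slopeWeight z θ₀ θ * (index z θ - index z θ₀) := by
  have hc : Tendsto (fun θ => index z θ) (𝓝 θ₀) (𝓝 (index z θ₀)) :=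
    (by unfold index; fun_prop : Continuous fun θ => index z θ).tendsto θ₀
  unfold score slopeWeight tlsScore ind
  rcases lt_trichotomy (index z θ₀) 0 with h0 | h0 | h0
  · rcases lt_or_gt_of_ne (hk₂ h0) with h | h
    · filter_upwards [hc.eventually_lt_const h0,
        hc.eventually_lt_const (show index z θ₀ < -y₂ z by linarith)] with θ k1 k2
      rw [if_pos k2.le, if_pos (by linarith), if_neg (by linarith), if_pos h0,
        if_neg (by linarith)]
      ring
    · filter_upwards [hc.eventually_lt_const h0,
        hc.eventually_const_lt (show -y₂ z < index z θ₀ by linarith)] with θ k1 k2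
      rw [if_neg (by linarith), if_pos (by linarith), if_neg (by linarith), if_pos (by linarith),
        if_neg (by linarith), if_pos h0, if_pos (by linarith)]
      ring
  · have e0 : (if index z θ₀ ≤ -y₂ z then -y₁ z else if index z θ₀ < y₁ z then
        y₂ z - y₁ z + index z θ₀ else y₂ z) = y₂ z - y₁ z := by
      split_ifs <;> linarith
    have e1 : ∀ᶠ θ in 𝓝 θ₀, 0 < y₁ z → index z θ < y₁ z := by
      by_cases h : 0 < y₁ z
      · filter_upwards [hc.eventually_lt_const (show index z θ₀ < y₁ z by linarith)] with θ hθ _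
        exact hθ
      · exact Eventually.of_forall fun θ h' => absurd h' h
    have e2 : ∀ᶠ θ in 𝓝 θ₀, 0 < y₂ z → -y₂ z < index z θ := by
      by_cases h : 0 < y₂ z
      · filter_upwards [hc.eventually_const_lt (show -y₂ z < index z θ₀ by linarith)] with θ hθ _
        exact hθ
      · exact Eventually.of_forall fun θ h' => absurd h' h
    filter_upwards [e1, e2] with θ k1 k2
    rw [e0, h0, if_neg (lt_irrefl _), if_neg (lt_irrefl _)]
    by_cases h1 : 0 < y₁ z <;> by_cases h2 : 0 < y₂ z <;> simp only [h1, h2, if_true, if_false] <;>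
      simp only [h1, h2, true_implies] at k1 k2 <;> split_ifs <;> linarith
  · rcases lt_or_gt_of_ne (hk₁ h0) with h | h
    · filter_upwards [hc.eventually_const_lt h0, hc.eventually_const_lt h] with θ k1 k2
      rw [if_neg (by linarith), if_neg (by linarith), if_neg (by linarith), if_neg (by linarith),
        if_pos h0, if_neg (by linarith)]
      ring
    · filter_upwards [hc.eventually_const_lt h0, hc.eventually_lt_const h] with θ k1 k2
      rw [if_neg (by linarith), if_pos (by linarith), if_neg (by linarith), if_pos (by linarith),
        if_pos h0, if_pos (by linarith)]
      ring

/-- The observation generated by the censored regression model from its primitives. -/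
noncomputable def ofErrors (θ₀ x₁ x₂ : RVec K) (α e₁ e₂ : ℝ) : PanelObs K :=
  (max 0 (α + inner ℝ x₁ θ₀ + e₁), x₁, max 0 (α + inner ℝ x₂ θ₀ + e₂), x₂)

/-! ### Identities under exchange of the two errors -/

section ofErrors

variable (θ₀ x₁ x₂ : RVec K) (α e₁ e₂ : ℝ)

theorem dx_ofErrors : dx (ofErrors θ₀ x₁ x₂ α e₁ e₂) = x₁ - x₂ := rfl

theorem index_ofErrors (θ : RVec K) : index (ofErrors θ₀ x₁ x₂ α e₁ e₂) θ = inner ℝ (x₁ - x₂) θ :=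
  rfl

theorem index_ofErrors_self :
    index (ofErrors θ₀ x₁ x₂ α e₁ e₂) θ₀ = inner ℝ x₁ θ₀ - inner ℝ x₂ θ₀ := inner_sub_left _ _ _

theorem y₁_ofErrors : y₁ (ofErrors θ₀ x₁ x₂ α e₁ e₂) = max 0 (α + inner ℝ x₁ θ₀ + e₁) := rfl

theorem y₂_ofErrors : y₂ (ofErrors θ₀ x₁ x₂ α e₁ e₂) = max 0 (α + inner ℝ x₂ θ₀ + e₂) := rfl

/-- At the true index the score equals `max e₂ c - max e₁ c`, where `c` depends only on the
regressors and the fixed effect; this is antisymmetric in the errors. -/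
theorem score_ofErrors_symm :
    score (ofErrors θ₀ x₁ x₂ α e₁ e₂) θ₀ + score (ofErrors θ₀ x₁ x₂ α e₂ e₁) θ₀ = 0 := by
  have key : ∀ a b e f : ℝ, tlsScore (a - b) (max 0 (a + e)) (max 0 (b + f)) =
      max f (max (-a) (-b)) - max e (max (-a) (-b)) := by
    intro a b e f
    rw [tlsScore_eq _ (le_max_left _ _) (le_max_left _ _)]
    grind
  have h : (inner ℝ x₁ θ₀ - inner ℝ x₂ θ₀ : ℝ) =
      (α + inner ℝ x₁ θ₀) - (α + inner ℝ x₂ θ₀) := by ring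
  unfold score
  simp only [index_ofErrors_self, y₁_ofErrors, y₂_ofErrors, h, key]
  ring

/-- For a positive true index, `index < y₁` amounts to `0 < α + x₂ᵀθ₀ + e₁`, which is the event `0 <
y₂` after the swap; the negative case mirrors it. At index zero the swap exchanges the two
positivity indicators, so their sum no longer depends on the direction. -/
theorem slopeWeight_ofErrors_symm (θ : RVec K) :
    (slopeWeight (ofErrors θ₀ x₁ x₂ α e₁ e₂) θ₀ θ + slopeWeight (ofErrors θ₀ x₁ x₂ α e₂ e₁) θ₀ θ) *
        (inner ℝ (x₁ - x₂) θ - inner ℝ (x₁ - x₂) θ₀) =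
      (midWeight (ofErrors θ₀ x₁ x₂ α e₁ e₂) θ₀ + midWeight (ofErrors θ₀ x₁ x₂ α e₂ e₁) θ₀) *
        (inner ℝ (x₁ - x₂) θ - inner ℝ (x₁ - x₂) θ₀) := by
  rw [inner_sub_left x₁ x₂ θ₀]
  unfold slopeWeight midWeight ind
  simp only [index_ofErrors_self, y₁_ofErrors, y₂_ofErrors, index_ofErrors, lt_max_iff, lt_irrefl,
    false_or]
  generalize (inner ℝ x₁ θ₀ : ℝ) = a
  generalize (inner ℝ x₂ θ₀ : ℝ) = b
  generalize (inner ℝ (x₁ - x₂) θ : ℝ) = t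
  rcases lt_trichotomy (a - b) 0 with h | h | h
  · grind
  · grind
  · grind

/-- The two weights differ only at index zero, where the swap exchanges the positivity indicators
and any split of total weight one gives the same sum. -/
theorem leftWeight_ofErrors_symm :
    leftWeight (ofErrors θ₀ x₁ x₂ α e₁ e₂) θ₀ + leftWeight (ofErrors θ₀ x₁ x₂ α e₂ e₁) θ₀ =
      midWeight (ofErrors θ₀ x₁ x₂ α e₁ e₂) θ₀ + midWeight (ofErrors θ₀ x₁ x₂ α e₂ e₁) θ₀ := by
  unfold leftWeight midWeight ind
  simp only [index_ofErrors_self, y₁_ofErrors, y₂_ofErrors, lt_max_iff, lt_irrefl, false_or]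
  generalize (inner ℝ x₁ θ₀ : ℝ) = a
  generalize (inner ℝ x₂ θ₀ : ℝ) = b
  rcases lt_trichotomy (a - b) 0 with h | h | h
  · grind
  · grind
  · grind

end ofErrors

end PanelObs

namespace CensoredPanel

variable {K : ℕ} {Ω : Type*} [MeasurableSpace Ω] (M : CensoredPanel K Ω) {P : Measure Ω}

/-! ### Exchangeability and absence of kinks -/

theorem measurable_W : Measurable M.W :=
  M.measurable_X₁.prodMk (M.measurable_X₂.prodMk M.measurable_α)

theorem measurable_ε : Measurable M.ε := M.measurable_ε₁.prodMk M.measurable_ε₂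

/-- The observation generated after exchanging the two errors. -/
noncomputable def swappedObs (ω : Ω) : PanelObs K :=
  PanelObs.ofErrors M.θ₀ (M.X₁ ω) (M.X₂ ω) (M.α ω) (M.ε₂ ω) (M.ε₁ ω)

theorem obs_eq_ofErrors (ω : Ω) :
    M.obs ω = PanelObs.ofErrors M.θ₀ (M.X₁ ω) (M.X₂ ω) (M.α ω) (M.ε₁ ω) (M.ε₂ ω) := rfl

theorem measurable_obs : Measurable M.obs := by
  have h1 := M.measurable_X₁
  have h2 := M.measurable_X₂
  have h3 := M.measurable_α
  have h4 := M.measurable_ε₁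
  have h5 := M.measurable_ε₂
  exact (measurable_const.max ((h3.add h1.inner_const).add h4)).prodMk
    (h1.prodMk ((measurable_const.max ((h3.add h2.inner_const).add h5)).prodMk h2))

variable {M} in
-- The joint law is the law of `W` composed with the conditional law of the errors, so invariance of
-- almost every conditional law passes to it.
theorem identDistrib_swap [IsProbabilityMeasure P] (h : M.ExchangeableErrors P) :
    IdentDistrib (fun ω => (M.W ω, M.ε ω)) (fun ω => (M.W ω, (M.ε ω).swap)) P P := by
  have hm := M.measurable_W.prodMk M.measurable_ε
  have hm' := M.measurable_W.prodMk (measurable_swap.comp M.measurable_ε)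
  refine ⟨hm.aemeasurable, hm'.aemeasurable, ?_⟩
  have hsw : Measurable (Prod.map id Prod.swap : (RVec K × RVec K × ℝ) × ℝ × ℝ → _) :=
    measurable_id.prodMap measurable_swap
  have e1 := compProd_map_condDistrib (mβ := inferInstance) (X := M.W) (μ := P) M.measurable_ε.aemeasurable
  have e2 : P.map (fun ω => (M.W ω, (M.ε ω).swap)) =
      (P.map fun ω => (M.W ω, M.ε ω)).map (Prod.map id Prod.swap) :=
    (Measure.map_map hsw hm).symm
  rw [e2, ← e1]
  ext s hs
  rw [Measure.map_apply hsw hs, Measure.compProd_apply hs, Measure.compProd_apply (hsw hs)]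
  refine lintegral_congr_ae ?_
  filter_upwards [h] with w hw
  conv_lhs => rw [← hw]
  rw [Measure.map_apply measurable_swap (measurable_prodMk_left hs)]
  rfl

variable {M} in
theorem identDistrib_obs_swappedObs [IsProbabilityMeasure P] (h : M.ExchangeableErrors P) :
    IdentDistrib M.obs M.swappedObs P P := by
  have hΦ : Measurable fun q : (RVec K × RVec K × ℝ) × ℝ × ℝ =>
      PanelObs.ofErrors M.θ₀ q.1.1 q.1.2.1 q.1.2.2 q.2.1 q.2.2 := by
    have h1 : Measurable fun q : (RVec K × RVec K × ℝ) × ℝ × ℝ => q.1.1 := measurable_fst.fst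
    have h2 : Measurable fun q : (RVec K × RVec K × ℝ) × ℝ × ℝ => q.1.2.1 := measurable_fst.snd.fst
    have h3 : Measurable fun q : (RVec K × RVec K × ℝ) × ℝ × ℝ => q.1.2.2 := measurable_fst.snd.snd
    have h4 : Measurable fun q : (RVec K × RVec K × ℝ) × ℝ × ℝ => q.2.1 := measurable_snd.fst
    have h5 : Measurable fun q : (RVec K × RVec K × ℝ) × ℝ × ℝ => q.2.2 := measurable_snd.snd
    exact (measurable_const.max ((h3.add h1.inner_const).add h4)).prodMk
      (h1.prodMk ((measurable_const.max ((h3.add h2.inner_const).add h5)).prodMk h2))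
  exact (identDistrib_swap h).comp hΦ

/-- Two functions of the observation with the same symmetrization in the errors have the same
expectation. -/
theorem integral_obs_eq_of_symm {M : CensoredPanel K Ω} [IsProbabilityMeasure P]
    (h : M.ExchangeableErrors P)
    {f g : PanelObs K → ℝ} (hf : Measurable f) (hg : Measurable g)
    (hfi : Integrable (fun ω => f (M.obs ω)) P) (hgi : Integrable (fun ω => g (M.obs ω)) P)
    (hfg : ∀ x₁ x₂ α e₁ e₂, f (PanelObs.ofErrors M.θ₀ x₁ x₂ α e₁ e₂) +
        f (PanelObs.ofErrors M.θ₀ x₁ x₂ α e₂ e₁) =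
      g (PanelObs.ofErrors M.θ₀ x₁ x₂ α e₁ e₂) + g (PanelObs.ofErrors M.θ₀ x₁ x₂ α e₂ e₁)) :
    ∫ ω, f (M.obs ω) ∂P = ∫ ω, g (M.obs ω) ∂P := by
  have hid := identDistrib_obs_swappedObs h
  have ef : ∫ ω, f (M.obs ω) ∂P = ∫ ω, f (M.swappedObs ω) ∂P := (hid.comp hf).integral_eq
  have eg : ∫ ω, g (M.obs ω) ∂P = ∫ ω, g (M.swappedObs ω) ∂P := (hid.comp hg).integral_eq
  have hfi' : Integrable (fun ω => f (M.swappedObs ω)) P := (hid.comp hf).integrable_iff.1 hfi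
  have hgi' : Integrable (fun ω => g (M.swappedObs ω)) P := (hid.comp hg).integrable_iff.1 hgi
  have hsum : ∫ ω, f (M.obs ω) + f (M.swappedObs ω) ∂P =
      ∫ ω, g (M.obs ω) + g (M.swappedObs ω) ∂P :=
    integral_congr_ae (Eventually.of_forall fun ω => hfg _ _ _ _ _)
  rw [integral_add hfi hfi', integral_add hgi hgi', ← ef, ← eg] at hsum
  linarith

variable {M} in
-- Fubini: a set whose sections over `W` are all Lebesgue null is null for the joint law, by
-- conditional absolute continuity.
theorem ae_ε_notMem [IsProbabilityMeasure P] (h : M.ContinuousErrors P)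
    {s : Set ((RVec K × RVec K × ℝ) × ℝ × ℝ)} (hs : MeasurableSet s)
    (h0 : ∀ w, (volume : Measure (ℝ × ℝ)) (Prod.mk w ⁻¹' s) = 0) :
    ∀ᵐ ω ∂P, (M.W ω, M.ε ω) ∉ s := by
  have hm := M.measurable_W.prodMk M.measurable_ε
  have e1 := compProd_map_condDistrib (mβ := inferInstance) (X := M.W) (μ := P) M.measurable_ε.aemeasurable
  have hz : (P.map fun ω => (M.W ω, M.ε ω)) s = 0 := by
    rw [← e1, Measure.compProd_apply hs]
    refine lintegral_eq_zero_of_ae_eq_zero ?_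
    filter_upwards [h] with w hw
    exact hw (h0 w)
  rw [Measure.map_apply hm hs] at hz
  exact measure_eq_zero_iff_ae_notMem.1 hz

variable {M} in
theorem ae_ε₁_ne [IsProbabilityMeasure P] (h : M.ContinuousErrors P)
    {g : RVec K × RVec K × ℝ → ℝ} (hg : Measurable g) : ∀ᵐ ω ∂P, M.ε₁ ω ≠ g (M.W ω) := by
  refine ae_ε_notMem h (s := {q | q.2.1 = g q.1})
    (measurableSet_eq_fun measurable_snd.fst (hg.comp measurable_fst)) fun w => ?_
  have : (Prod.mk w ⁻¹' {q : (RVec K × RVec K × ℝ) × ℝ × ℝ | q.2.1 = g q.1}) =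
      ({g w} : Set ℝ) ×ˢ Set.univ := by ext; simp
  rw [this, Measure.volume_eq_prod, Measure.prod_prod]
  simp

variable {M} in
theorem ae_ε₂_ne [IsProbabilityMeasure P] (h : M.ContinuousErrors P)
    {g : RVec K × RVec K × ℝ → ℝ} (hg : Measurable g) : ∀ᵐ ω ∂P, M.ε₂ ω ≠ g (M.W ω) := by
  refine ae_ε_notMem h (s := {q | q.2.2 = g q.1})
    (measurableSet_eq_fun measurable_snd.snd (hg.comp measurable_fst)) fun w => ?_
  have : (Prod.mk w ⁻¹' {q : (RVec K × RVec K × ℝ) × ℝ × ℝ | q.2.2 = g q.1}) =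
      Set.univ ×ˢ ({g w} : Set ℝ) := by ext; simp
  rw [this, Measure.volume_eq_prod, Measure.prod_prod]
  simp

theorem y₁_obs_nonneg (ω : Ω) : 0 ≤ (M.obs ω).y₁ := le_max_left _ _

theorem y₂_obs_nonneg (ω : Ω) : 0 ≤ (M.obs ω).y₂ := le_max_left _ _

variable {M} in
/-- Almost surely the index is not at a kink of the score at which it has no one-sided
slope given by `PanelObs.slopeWeight`. -/
theorem ae_eventually_score_sub_eq [IsProbabilityMeasure P] (h : M.ContinuousErrors P) :
    ∀ᵐ ω ∂P, ∀ᶠ θ in 𝓝 M.θ₀, (M.obs ω).score θ - (M.obs ω).score M.θ₀ =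
      (M.obs ω).slopeWeight M.θ₀ θ * ((M.obs ω).index θ - (M.obs ω).index M.θ₀) := by
  -- If the outcome is uncensored, the kink `Y₁ = ΔXᵀθ₀` reads `ε₁ = -(α + X₂ᵀθ₀)`, because `X₁ᵀθ₀`
  -- cancels. Likewise `Y₂ = -ΔXᵀθ₀` reads `ε₂ = -(α + X₁ᵀθ₀)`.
  have hg₁ : Measurable fun w : RVec K × RVec K × ℝ => -(w.2.2 + inner ℝ w.2.1 M.θ₀) :=
    (measurable_snd.snd.add measurable_snd.fst.inner_const).neg
  have hg₂ : Measurable fun w : RVec K × RVec K × ℝ => -(w.2.2 + inner ℝ w.1 M.θ₀) :=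
    (measurable_snd.snd.add measurable_fst.inner_const).neg
  filter_upwards [ae_ε₁_ne h hg₁, ae_ε₂_ne h hg₂] with ω h1 h2
  refine PanelObs.eventually_score_sub_eq (M.y₁_obs_nonneg ω) (M.y₂_obs_nonneg ω) ?_ ?_
  · rw [obs_eq_ofErrors, PanelObs.index_ofErrors_self, PanelObs.y₁_ofErrors]
    intro hpos he
    rcases max_choice 0 (M.α ω + inner ℝ (M.X₁ ω) M.θ₀ + M.ε₁ ω) with hc | hc <;> rw [hc] at he
    · linarith
    · exact h1 (by simp only [W]; linarith)
  · rw [obs_eq_ofErrors, PanelObs.index_ofErrors_self, PanelObs.y₂_ofErrors]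
    intro hpos he
    rcases max_choice 0 (M.α ω + inner ℝ (M.X₂ ω) M.θ₀ + M.ε₂ ω) with hc | hc <;> rw [hc] at he
    · linarith
    · exact h2 (by simp only [W]; linarith)

/-! ### Moments -/

theorem measurable_dX : Measurable M.dX := M.measurable_X₁.sub M.measurable_X₂

theorem measurable_score (θ : RVec K) : Measurable fun ω => (M.obs ω).score θ :=
  (PanelObs.measurable_score θ).comp M.measurable_obs

section Moments

variable {M}

theorem integrable_norm_dX_pow_four (h : M.MomentConditions P) :
    Integrable (fun ω => ‖M.dX ω‖ ^ 4) P := by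
  refine ((h.1.add h.2.1).const_mul 8).mono'
    (M.measurable_dX.norm.pow_const 4).aestronglyMeasurable (Eventually.of_forall fun ω => ?_)
  rw [Real.norm_of_nonneg (by positivity)]
  have h1 : ‖M.dX ω‖ ≤ ‖M.X₁ ω‖ + ‖M.X₂ ω‖ := norm_sub_le _ _
  have h2 := pow_le_pow_left₀ (norm_nonneg _) h1 4
  refine h2.trans ((add_pow_le (norm_nonneg _) (norm_nonneg _) 4).trans ?_)
  norm_num

theorem integrable_norm_dX_sq [IsProbabilityMeasure P] (h : M.MomentConditions P) :
    Integrable (fun ω => ‖M.dX ω‖ ^ 2) P := by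
  refine ((integrable_norm_dX_pow_four h).add (integrable_const (1 : ℝ))).mono'
    (M.measurable_dX.norm.pow_const 2).aestronglyMeasurable (Eventually.of_forall fun ω => ?_)
  rw [Real.norm_of_nonneg (by positivity)]
  simp only [Pi.add_apply]
  nlinarith [sq_nonneg (‖M.dX ω‖ ^ 2 - 1)]

theorem abs_outer_le (v : RVec K) (j k : Fin K) : |outer v j k| ≤ ‖v‖ ^ 2 := by
  simp only [outer, Matrix.of_apply]
  rw [abs_mul, sq]
  exact mul_le_mul (PiLp.norm_apply_le v j) (PiLp.norm_apply_le v k) (abs_nonneg _)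
    (norm_nonneg _)

theorem measurable_outer (j k : Fin K) : Measurable fun v : RVec K => outer v j k := by
  unfold outer
  simp only [Matrix.of_apply]
  fun_prop

/-- This is the trace of the matrix integrand. -/
theorem integrable_score_sq_mul (h : M.VExists P) :
    Integrable (fun ω => (M.obs ω).score M.θ₀ ^ 2 * ‖M.dX ω‖ ^ 2) P := by
  have : (fun ω => (M.obs ω).score M.θ₀ ^ 2 * ‖M.dX ω‖ ^ 2) =
      fun ω => ∑ j, (M.obs ω).score M.θ₀ ^ 2 * outer (M.dX ω) j j := by
    funext ω
    rw [EuclideanSpace.real_norm_sq_eq, Finset.mul_sum]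
    refine Finset.sum_congr rfl fun j _ => ?_
    simp [outer, sq]
  rw [this]
  exact integrable_finsetSum _ fun j _ => h j j

theorem integrable_abs_score_mul [IsProbabilityMeasure P] (h : M.VExists P) :
    Integrable (fun ω => |(M.obs ω).score M.θ₀| * ‖M.dX ω‖) P := by
  refine ((integrable_score_sq_mul h).add (integrable_const (1 : ℝ))).mono'
    ((M.measurable_score _).abs.mul M.measurable_dX.norm).aestronglyMeasurable
    (Eventually.of_forall fun ω => ?_)
  rw [Real.norm_of_nonneg (by positivity)]
  simp only [Pi.add_apply]
  rw [← mul_pow, ← sq_abs, abs_mul, abs_norm]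
  nlinarith [sq_nonneg (|(M.obs ω).score M.θ₀| * ‖M.dX ω‖ - 1)]

/-- The product of `|score| * ‖ΔX‖` and `‖ΔX‖ ^ 2` is dominated by the sum of their squares. It is
the cross term in the error of the outer-product estimator. -/
theorem integrable_abs_score_mul_cube (hm : M.MomentConditions P) (h : M.VExists P) :
    Integrable (fun ω => |(M.obs ω).score M.θ₀| * ‖M.dX ω‖ ^ 3) P := by
  refine ((integrable_score_sq_mul h).add (integrable_norm_dX_pow_four hm)).mono'
    ((M.measurable_score _).abs.mul (M.measurable_dX.norm.pow_const 3)).aestronglyMeasurable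
    (Eventually.of_forall fun ω => ?_)
  rw [Real.norm_of_nonneg (by positivity)]
  simp only [Pi.add_apply]
  rw [← sq_abs ((M.obs ω).score M.θ₀)]
  nlinarith [sq_nonneg (|(M.obs ω).score M.θ₀| * ‖M.dX ω‖ - ‖M.dX ω‖ ^ 2),
    sq_nonneg (|(M.obs ω).score M.θ₀| * ‖M.dX ω‖), sq_nonneg (‖M.dX ω‖ ^ 2)]

theorem integrable_score_smul [IsProbabilityMeasure P] (hm : M.MomentConditions P)
    (h : M.VExists P) (θ : RVec K) : Integrable (fun ω => (M.obs ω).score θ • M.dX ω) P := by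
  refine ((integrable_abs_score_mul h).add
    ((integrable_norm_dX_sq hm).mul_const ‖θ - M.θ₀‖)).mono'
    ((M.measurable_score _).smul M.measurable_dX).aestronglyMeasurable
    (Eventually.of_forall fun ω => ?_)
  have h1 : |(M.obs ω).score θ - (M.obs ω).score M.θ₀| ≤ ‖M.dX ω‖ * ‖θ - M.θ₀‖ :=
    PanelObs.abs_score_sub_le (M.y₁_obs_nonneg ω) (M.y₂_obs_nonneg ω) _ _
  have h2 := abs_sub_abs_le_abs_sub ((M.obs ω).score θ) ((M.obs ω).score M.θ₀)
  rw [norm_smul, Real.norm_eq_abs]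
  simp only [Pi.add_apply]
  nlinarith [norm_nonneg (M.dX ω)]

/-- A bounded weight times a product of two linear forms in the regressor difference is
integrable. -/
theorem integrable_weight_mul [IsProbabilityMeasure P] (hm : M.MomentConditions P)
    {w : Ω → ℝ} (hw : Measurable w) (hw1 : ∀ ω, |w ω| ≤ 1) {q : RVec K → ℝ} (hq : Measurable q)
    {c : ℝ} (hq1 : ∀ v, |q v| ≤ c * ‖v‖ ^ 2) :
    Integrable (fun ω => w ω * q (M.dX ω)) P := by
  refine ((integrable_norm_dX_sq hm).const_mul c).mono'
    (hw.mul (hq.comp M.measurable_dX)).aestronglyMeasurable (Eventually.of_forall fun ω => ?_)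
  rw [Real.norm_eq_abs, abs_mul]
  calc |w ω| * |q (M.dX ω)| ≤ 1 * (c * ‖M.dX ω‖ ^ 2) := by gcongr; exacts [hw1 ω, hq1 _]
    _ = _ := one_mul _

end Moments

end CensoredPanel

namespace CensoredPanel

variable {K : ℕ} {Ω : Type*} [MeasurableSpace Ω] {M : CensoredPanel K Ω} {P : Measure Ω}

/-! ### The Jacobian of the expected score -/

theorem measurable_midWeight (θ : RVec K) : Measurable fun ω => (M.obs ω).midWeight θ :=
  (PanelObs.measurable_midWeight θ).comp M.measurable_obs

theorem measurable_slopeWeight (θ₀ θ : RVec K) :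
    Measurable fun ω => (M.obs ω).slopeWeight θ₀ θ :=
  (PanelObs.measurable_slopeWeight θ₀ θ).comp M.measurable_obs

theorem abs_midWeight_le_one (z : PanelObs K) (θ : RVec K) : |z.midWeight θ| ≤ 1 := by
  rw [abs_of_nonneg (PanelObs.midWeight_mem z θ).1]
  exact (PanelObs.midWeight_mem z θ).2

theorem abs_slopeWeight_le_one (z : PanelObs K) (θ₀ θ : RVec K) : |z.slopeWeight θ₀ θ| ≤ 1 := by
  rw [abs_of_nonneg (PanelObs.slopeWeight_nonneg z θ₀ θ)]
  exact PanelObs.slopeWeight_le_one z θ₀ θ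

theorem abs_inner_mul_coord_le (u v : RVec K) (j : Fin K) :
    |inner ℝ v u * v j| ≤ ‖u‖ * ‖v‖ ^ 2 := by
  rw [abs_mul]
  calc |inner ℝ v u| * |v j| ≤ (‖v‖ * ‖u‖) * ‖v‖ :=
        mul_le_mul (abs_real_inner_le_norm _ _) (PiLp.norm_apply_le v j) (abs_nonneg _)
          (by positivity)
    _ = _ := by ring

theorem abs_inner_sq_le (u v : RVec K) : |(inner ℝ v u : ℝ) ^ 2| ≤ ‖u‖ ^ 2 * ‖v‖ ^ 2 := by
  rw [abs_pow, ← mul_pow, mul_comm ‖u‖]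
  exact pow_le_pow_left₀ (abs_nonneg _) (abs_real_inner_le_norm _ _) 2

theorem measurable_inner_mul_coord (u : RVec K) (j : Fin K) :
    Measurable fun v : RVec K => (inner ℝ v u : ℝ) * v j :=
  (by fun_prop : Continuous fun v : RVec K => (inner ℝ v u : ℝ) * v j).measurable

theorem measurable_inner_sq (u : RVec K) : Measurable fun v : RVec K => (inner ℝ v u : ℝ) ^ 2 :=
  (by fun_prop : Continuous fun v : RVec K => (inner ℝ v u : ℝ) ^ 2).measurable

theorem integrable_weight_inner_smul [IsProbabilityMeasure P] (hm : M.MomentConditions P)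
    {w : Ω → ℝ} (hw : Measurable w) (hw1 : ∀ ω, |w ω| ≤ 1) (u : RVec K) :
    Integrable (fun ω => (w ω * inner ℝ (M.dX ω) u) • M.dX ω) P := by
  refine ((integrable_norm_dX_sq hm).const_mul ‖u‖).mono'
    ((hw.mul (M.measurable_dX.inner_const)).smul M.measurable_dX).aestronglyMeasurable
    (Eventually.of_forall fun ω => ?_)
  rw [norm_smul, norm_mul, Real.norm_eq_abs, Real.norm_eq_abs]
  calc |w ω| * |inner ℝ (M.dX ω) u| * ‖M.dX ω‖ ≤ 1 * (‖M.dX ω‖ * ‖u‖) * ‖M.dX ω‖ := by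
        gcongr
        exacts [hw1 ω, abs_real_inner_le_norm _ _]
    _ = _ := by ring

/-- The derivative of the expected score at `θ₀`. -/
noncomputable def scoreDeriv [IsProbabilityMeasure P] (hm : M.MomentConditions P) :
    RVec K →L[ℝ] RVec K :=
  LinearMap.toContinuousLinearMap
    { toFun := fun u => ∫ ω, ((M.obs ω).midWeight M.θ₀ * inner ℝ (M.dX ω) u) • M.dX ω ∂P
      map_add' := fun u v => by
        rw [← integral_add
          (integrable_weight_inner_smul hm (measurable_midWeight _)
            (fun ω => abs_midWeight_le_one _ _) u)
          (integrable_weight_inner_smul hm (measurable_midWeight _)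
            (fun ω => abs_midWeight_le_one _ _) v)]
        simp only [inner_add_right, mul_add, add_smul]
      map_smul' := fun c u => by
        rw [RingHom.id_apply, ← integral_smul]
        simp only [real_inner_smul_right, smul_smul]
        congr with ω : 1
        ring_nf }

theorem scoreDeriv_apply [IsProbabilityMeasure P] (hm : M.MomentConditions P) (u : RVec K) :
    scoreDeriv hm u =
      ∫ ω, ((M.obs ω).midWeight M.θ₀ * inner ℝ (M.dX ω) u) • M.dX ω ∂P := rfl

theorem integral_apply_coord {f : Ω → RVec K} (hf : Integrable f P) (j : Fin K) :
    (∫ ω, f ω ∂P) j = ∫ ω, f ω j ∂P :=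
  ((EuclideanSpace.proj (𝕜 := ℝ) j).integral_comp_comm hf).symm

/-- The left-hand weight still depends on `θ`; symmetrization removes that dependence and leaves a
linear function of the increment. -/
theorem integral_slopeWeight_smul [IsProbabilityMeasure P] (hm : M.MomentConditions P)
    (he : M.ExchangeableErrors P) (θ : RVec K) :
    ∫ ω, ((M.obs ω).slopeWeight M.θ₀ θ * inner ℝ (M.dX ω) (θ - M.θ₀)) • M.dX ω ∂P =
      scoreDeriv hm (θ - M.θ₀) := by
  rw [scoreDeriv_apply]
  ext j
  rw [integral_apply_coord (integrable_weight_inner_smul hm (measurable_slopeWeight _ _)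
      (fun ω => abs_slopeWeight_le_one _ _ _) _),
    integral_apply_coord (integrable_weight_inner_smul hm (measurable_midWeight _)
      (fun ω => abs_midWeight_le_one _ _) _)]
  simp only [PiLp.smul_apply, smul_eq_mul, mul_assoc]
  have hq := (measurable_inner_mul_coord (θ - M.θ₀) j).comp (PanelObs.measurable_dx (K := K))
  refine integral_obs_eq_of_symm he
    (f := fun z => z.slopeWeight M.θ₀ θ * (inner ℝ z.dx (θ - M.θ₀) * z.dx j))
    (g := fun z => z.midWeight M.θ₀ * (inner ℝ z.dx (θ - M.θ₀) * z.dx j))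
    ((PanelObs.measurable_slopeWeight _ _).mul hq) ((PanelObs.measurable_midWeight _).mul hq)
    (integrable_weight_mul hm (measurable_slopeWeight _ _)
      (fun ω => abs_slopeWeight_le_one _ _ _) (measurable_inner_mul_coord _ j)
      (fun v => abs_inner_mul_coord_le _ v j))
    (integrable_weight_mul hm (measurable_midWeight _)
      (fun ω => abs_midWeight_le_one _ _) (measurable_inner_mul_coord _ j)
      (fun v => abs_inner_mul_coord_le _ v j)) fun x₁ x₂ α e₁ e₂ => ?_
  have hs := PanelObs.slopeWeight_ofErrors_symm M.θ₀ x₁ x₂ α e₁ e₂ θ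
  simp only [PanelObs.dx_ofErrors, inner_sub_right (x₁ - x₂)]
  linear_combination (x₁ - x₂) j * hs

/-- The linearization remainder is almost surely zero for `θ` close enough to `θ₀`, and divided by
`‖θ - θ₀‖` it is bounded by `2 * ‖ΔX‖ ^ 2`. Dominated convergence concludes. -/
theorem hasFDerivAt_G [IsProbabilityMeasure P] (hm : M.MomentConditions P) (hV : M.VExists P)
    (hc : M.ContinuousErrors P) (he : M.ExchangeableErrors P) :
    HasFDerivAt (M.G P) (scoreDeriv hm) M.θ₀ := by
  set R : RVec K → Ω → RVec K := fun θ ω =>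
    ((M.obs ω).score θ - (M.obs ω).score M.θ₀ -
      (M.obs ω).slopeWeight M.θ₀ θ * inner ℝ (M.dX ω) (θ - M.θ₀)) • M.dX ω with hR
  have hRm : ∀ θ, Measurable (R θ) := fun θ =>
    (((M.measurable_score θ).sub (M.measurable_score M.θ₀)).sub
      ((measurable_slopeWeight _ _).mul M.measurable_dX.inner_const)).smul M.measurable_dX
  have hRb : ∀ θ ω, ‖R θ ω‖ ≤ ‖θ - M.θ₀‖ * (2 * ‖M.dX ω‖ ^ 2) := fun θ ω => by
    have h1 : |(M.obs ω).score θ - (M.obs ω).score M.θ₀| ≤ ‖M.dX ω‖ * ‖θ - M.θ₀‖ :=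
      PanelObs.abs_score_sub_le (M.y₁_obs_nonneg ω) (M.y₂_obs_nonneg ω) _ _
    have h2 : |(M.obs ω).slopeWeight M.θ₀ θ * inner ℝ (M.dX ω) (θ - M.θ₀)| ≤
        ‖M.dX ω‖ * ‖θ - M.θ₀‖ := by
      rw [abs_mul]
      calc _ ≤ 1 * (‖M.dX ω‖ * ‖θ - M.θ₀‖) := by
            gcongr
            exacts [abs_slopeWeight_le_one _ _ _, abs_real_inner_le_norm _ _]
        _ = _ := one_mul _
    rw [hR, norm_smul, Real.norm_eq_abs]
    calc _ ≤ (‖M.dX ω‖ * ‖θ - M.θ₀‖ + ‖M.dX ω‖ * ‖θ - M.θ₀‖) * ‖M.dX ω‖ := by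
          gcongr
          exact (abs_sub _ _).trans (add_le_add h1 h2)
      _ = _ := by ring
  have hGR : ∀ θ, M.G P θ - M.G P M.θ₀ - scoreDeriv hm (θ - M.θ₀) = ∫ ω, R θ ω ∂P := fun θ => by
    have hdiff : Integrable
        (fun ω => (M.obs ω).score θ • M.dX ω - (M.obs ω).score M.θ₀ • M.dX ω) P :=
      (integrable_score_smul hm hV θ).sub (integrable_score_smul hm hV M.θ₀)
    rw [← integral_slopeWeight_smul hm he, G, G,
      ← integral_sub (integrable_score_smul hm hV θ) (integrable_score_smul hm hV M.θ₀),
      ← integral_sub hdiff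
        (integrable_weight_inner_smul hm (measurable_slopeWeight _ _)
          (fun ω => abs_slopeWeight_le_one _ _ _) _)]
    simp only [hR, sub_smul]
  rw [hasFDerivAt_iff_tendsto]
  have hlim : Tendsto (fun θ => ∫ ω, ‖θ - M.θ₀‖⁻¹ * ‖R θ ω‖ ∂P) (𝓝 M.θ₀) (𝓝 (∫ _, (0 : ℝ) ∂P)) := by
    refine tendsto_integral_filter_of_dominated_convergence (fun ω => 2 * ‖M.dX ω‖ ^ 2)
      (Eventually.of_forall fun θ => ((hRm θ).norm.const_mul _).aestronglyMeasurable)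
      (Eventually.of_forall fun θ => Eventually.of_forall fun ω => ?_)
      ((integrable_norm_dX_sq hm).const_mul 2) ?_
    · rw [Real.norm_of_nonneg (by positivity)]
      rcases eq_or_ne (‖θ - M.θ₀‖) 0 with h | h
      · rw [h, inv_zero, zero_mul]
        positivity
      · calc _ ≤ ‖θ - M.θ₀‖⁻¹ * (‖θ - M.θ₀‖ * (2 * ‖M.dX ω‖ ^ 2)) := by
              gcongr
              exact hRb θ ω
          _ = _ := inv_mul_cancel_left₀ h _
    · filter_upwards [ae_eventually_score_sub_eq hc] with ω hω
      refine tendsto_const_nhds.congr' ?_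
      filter_upwards [hω] with θ hθ
      have : R θ ω = 0 := by
        simp only [hR]
        rw [hθ, PanelObs.index_sub]
        exact (congrArg (· • M.dX ω) (sub_self _)).trans (zero_smul _ _)
      rw [this, norm_zero, mul_zero]
  rw [integral_zero] at hlim
  refine squeeze_zero (fun θ => by positivity) (fun θ => ?_) hlim
  rw [hGR, integral_const_mul]
  gcongr
  exact norm_integral_le_integral_norm _

theorem integrable_midWeight_mul_outer [IsProbabilityMeasure P] (hm : M.MomentConditions P)
    (θ : RVec K) (j k : Fin K) :
    Integrable (fun ω => (M.obs ω).midWeight θ * outer (M.dX ω) j k) P :=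
  integrable_weight_mul hm (measurable_midWeight _) (fun ω => abs_midWeight_le_one _ _)
    (measurable_outer j k) (c := 1) fun v => by rw [one_mul]; exact abs_outer_le v j k

theorem J₀_apply [IsProbabilityMeasure P] (hm : M.MomentConditions P) (hV : M.VExists P)
    (hc : M.ContinuousErrors P) (he : M.ExchangeableErrors P) (j k : Fin K) :
    M.J₀ P j k = ∫ ω, (M.obs ω).midWeight M.θ₀ * outer (M.dX ω) j k ∂P := by
  rw [J₀, Matrix.of_apply, (hasFDerivAt_G hm hV hc he).fderiv, scoreDeriv_apply,
    integral_apply_coord (integrable_weight_inner_smul hm (measurable_midWeight _)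
      (fun ω => abs_midWeight_le_one _ _) _)]
  refine integral_congr_ae (Eventually.of_forall fun ω => ?_)
  simp only [PiLp.smul_apply, smul_eq_mul, outer, Matrix.of_apply]
  rw [EuclideanSpace.inner_single_right]
  simp
  ring

/-- Symmetrization replaces `midWeight` by the weight of the rank condition. A vanishing nonnegative
integral then puts the weighted regressor difference almost surely in the orthogonal complement of
`v`, which must be the whole space. -/
theorem eq_zero_of_integral_midWeight [IsProbabilityMeasure P] (hm : M.MomentConditions P)
    (he : M.ExchangeableErrors P) (hj : M.JacobianRank P) {v : RVec K}
    (hv : ∫ ω, (M.obs ω).midWeight M.θ₀ * (inner ℝ (M.dX ω) v : ℝ) ^ 2 ∂P = 0) : v = 0 := by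
  have hlm : Measurable fun ω => (M.obs ω).leftWeight M.θ₀ :=
    (PanelObs.measurable_leftWeight _).comp M.measurable_obs
  have hl1 : ∀ z : PanelObs K, |z.leftWeight M.θ₀| ≤ 1 := fun z => by
    rw [abs_of_nonneg (PanelObs.leftWeight_mem z _).1]
    exact (PanelObs.leftWeight_mem z _).2
  have hli : Integrable (fun ω => (M.obs ω).leftWeight M.θ₀ * (inner ℝ (M.dX ω) v : ℝ) ^ 2) P :=
    integrable_weight_mul hm hlm (fun ω => hl1 _) (measurable_inner_sq v) (abs_inner_sq_le v)
  have hq := (measurable_inner_sq v).comp (PanelObs.measurable_dx (K := K))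
  have heq : ∫ ω, (M.obs ω).leftWeight M.θ₀ * (inner ℝ (M.dX ω) v : ℝ) ^ 2 ∂P = 0 := by
    rw [← hv]
    refine integral_obs_eq_of_symm he
      (f := fun z => z.leftWeight M.θ₀ * (inner ℝ z.dx v : ℝ) ^ 2)
      (g := fun z => z.midWeight M.θ₀ * (inner ℝ z.dx v : ℝ) ^ 2)
      ((PanelObs.measurable_leftWeight _).mul hq) ((PanelObs.measurable_midWeight _).mul hq) hli
      (integrable_weight_mul hm (measurable_midWeight _)
        (fun ω => abs_midWeight_le_one _ _) (measurable_inner_sq v) (abs_inner_sq_le v))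
      fun x₁ x₂ α e₁ e₂ => ?_
    have hs := PanelObs.leftWeight_ofErrors_symm M.θ₀ x₁ x₂ α e₁ e₂
    simp only [PanelObs.dx_ofErrors]
    linear_combination (inner ℝ (x₁ - x₂) v : ℝ) ^ 2 * hs
  rw [integral_eq_zero_iff_of_nonneg
    (fun ω => mul_nonneg (PanelObs.leftWeight_mem _ _).1 (sq_nonneg _)) hli] at heq
  have htop := hj (ℝ ∙ v)ᗮ (by
    filter_upwards [heq] with ω hω
    rw [Submodule.mem_orthogonal_singleton_iff_inner_left, real_inner_smul_left]
    have hω' : (M.obs ω).leftWeight M.θ₀ * (inner ℝ (M.dX ω) v : ℝ) ^ 2 = 0 := hω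
    rcases mul_eq_zero.1 hω' with h | h
    · have h' : ind (0 < M.Y₁ ω) * ind (inner ℝ (M.dX ω) M.θ₀ ≤ 0) +
        ind (0 < M.Y₂ ω) * ind (0 < inner ℝ (M.dX ω) M.θ₀) = 0 := h
      rw [h', zero_mul]
    · rw [pow_eq_zero_iff two_ne_zero] at h
      rw [h, mul_zero])
  have hmem : v ∈ (ℝ ∙ v)ᗮ := htop ▸ Submodule.mem_top
  rw [Submodule.mem_orthogonal_singleton_iff_inner_left] at hmem
  exact inner_self_eq_zero.1 hmem

/-- A kernel vector would annihilate the quadratic form, which is definite. -/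
theorem isUnit_det_J₀ [IsProbabilityMeasure P] (hm : M.MomentConditions P) (hV : M.VExists P)
    (hc : M.ContinuousErrors P) (he : M.ExchangeableErrors P) (hj : M.JacobianRank P) :
    IsUnit (M.J₀ P).det := by
  rw [isUnit_iff_ne_zero]
  intro hdet
  obtain ⟨v, hv0, hv⟩ := Matrix.exists_mulVec_eq_zero_iff.2 hdet
  refine hv0 ?_
  have hquad : ∫ ω, (M.obs ω).midWeight M.θ₀ *
      (inner ℝ (M.dX ω) (WithLp.toLp 2 v : RVec K) : ℝ) ^ 2 ∂P = v ⬝ᵥ (M.J₀ P).mulVec v := by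
    have e : ∀ ω, (M.obs ω).midWeight M.θ₀ *
        (inner ℝ (M.dX ω) (WithLp.toLp 2 v : RVec K) : ℝ) ^ 2 =
        ∑ j, ∑ k, v j * v k * ((M.obs ω).midWeight M.θ₀ * outer (M.dX ω) j k) := fun ω => by
      have : (inner ℝ (M.dX ω) (WithLp.toLp 2 v : RVec K) : ℝ) = ∑ j, v j * M.dX ω j := by
        simp [PiLp.inner_apply]
      rw [this, sq, Finset.sum_mul_sum, Finset.mul_sum]
      refine Finset.sum_congr rfl fun j _ => ?_
      rw [Finset.mul_sum]
      refine Finset.sum_congr rfl fun k _ => ?_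
      simp only [outer, Matrix.of_apply]
      ring
    simp only [e]
    rw [integral_finsetSum _ fun j _ => integrable_finsetSum _ fun k _ =>
      (integrable_midWeight_mul_outer hm _ j k).const_mul _]
    simp only [dotProduct, Matrix.mulVec, Finset.mul_sum]
    refine Finset.sum_congr rfl fun j _ => ?_
    rw [integral_finsetSum _ fun k _ => (integrable_midWeight_mul_outer hm _ j k).const_mul _]
    refine Finset.sum_congr rfl fun k _ => ?_
    rw [integral_const_mul, J₀_apply hm hV hc he]
    ring
  rw [hv, dotProduct_zero] at hquad
  have := eq_zero_of_integral_midWeight hm he hj hquad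
  simpa using this

end CensoredPanel

namespace PanelObs

variable {K : ℕ}

theorem abs_loss_sub_le {z : PanelObs K} (h₁ : 0 ≤ y₁ z) (h₂ : 0 ≤ y₂ z) {θ₀ θ θ' : RVec K}
    {r : ℝ} (hθ : ‖θ - θ₀‖ ≤ r) (hθ' : ‖θ' - θ₀‖ ≤ r) :
    |loss z θ - loss z θ'| ≤ ‖θ - θ'‖ * (|score z θ₀| * ‖dx z‖ + r * ‖dx z‖ ^ 2) := by
  have hr : ∀ {η : RVec K}, ‖η - θ₀‖ ≤ r → |index z η - index z θ₀| ≤ ‖dx z‖ * r := fun h =>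
    (abs_index_sub_le z _ _).trans (by gcongr)
  calc |loss z θ - loss z θ'| ≤ |index z θ - index z θ'| * (|score z θ₀| +
        max |index z θ - index z θ₀| |index z θ' - index z θ₀|) := abs_tlsLoss_sub_le _ _ _ h₁ h₂
    _ ≤ (‖dx z‖ * ‖θ - θ'‖) * (|score z θ₀| + ‖dx z‖ * r) := by
        gcongr
        exacts [abs_index_sub_le z _ _, max_le (hr hθ) (hr hθ')]
    _ = _ := by ring

end PanelObs

namespace CensoredPanel

variable {K : ℕ} {Ω Ω' : Type*} [MeasurableSpace Ω] [MeasurableSpace Ω'] {M : CensoredPanel K Ω}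
  {P : Measure Ω} {Q : Measure Ω'} {Z : ℕ → Ω' → PanelObs K}

/-! ### Consistency of the estimator -/

theorem integrable_lossBound [IsProbabilityMeasure P] (hm : M.MomentConditions P)
    (hV : M.VExists P) (r : ℝ) :
    Integrable (fun ω => |(M.obs ω).score M.θ₀| * ‖M.dX ω‖ + r * ‖M.dX ω‖ ^ 2) P :=
  (integrable_abs_score_mul hV).add ((integrable_norm_dX_sq hm).const_mul r)

/-- Losses are centred at `θ₀` because the assumed moments control increments of the loss;
integrability of the loss itself is not needed. -/
theorem integrable_loss_sub [IsProbabilityMeasure P] (hm : M.MomentConditions P)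
    (hV : M.VExists P) (θ : RVec K) :
    Integrable (fun ω => (M.obs ω).loss θ - (M.obs ω).loss M.θ₀) P := by
  refine ((integrable_lossBound hm hV ‖θ - M.θ₀‖).const_mul ‖θ - M.θ₀‖).mono'
    (((PanelObs.measurable_loss θ).sub (PanelObs.measurable_loss M.θ₀)).comp
      M.measurable_obs).aestronglyMeasurable (Eventually.of_forall fun ω => ?_)
  exact PanelObs.abs_loss_sub_le (M.y₁_obs_nonneg ω) (M.y₂_obs_nonneg ω) le_rfl (by simp)

/-- The population criterion is uniquely minimized at `θ₀`. -/
theorem integral_loss_sub_pos [IsProbabilityMeasure P] (hm : M.MomentConditions P)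
    (hV : M.VExists P) (he : M.ExchangeableErrors P) (hj : M.JacobianRank P) {θ : RVec K}
    (hθ : θ ≠ M.θ₀) : 0 < ∫ ω, ((M.obs ω).loss θ - (M.obs ω).loss M.θ₀) ∂P := by
  set u := θ - M.θ₀ with hu
  have hsi : Integrable (fun ω => (M.obs ω).score M.θ₀ * inner ℝ (M.dX ω) u) P := by
    refine ((integrable_abs_score_mul hV).mul_const ‖u‖).mono'
      ((M.measurable_score _).mul M.measurable_dX.inner_const).aestronglyMeasurable
      (Eventually.of_forall fun ω => ?_)
    rw [norm_mul, Real.norm_eq_abs, Real.norm_eq_abs, mul_assoc]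
    gcongr
    exact abs_real_inner_le_norm _ _
  -- First-order condition: the score at `θ₀` is antisymmetric under the swap. The tangent term can
  -- therefore be subtracted, which leaves a nonnegative integrand.
  have hs0 : ∫ ω, (M.obs ω).score M.θ₀ * inner ℝ (M.dX ω) u ∂P = 0 := by
    have := integral_obs_eq_of_symm he (P := P)
      (f := fun z => z.score M.θ₀ * inner ℝ z.dx u) (g := fun _ => 0)
      ((PanelObs.measurable_score _).mul PanelObs.measurable_dx.inner_const) measurable_const
      hsi (integrable_const _) fun x₁ x₂ α e₁ e₂ => by
        have hs := PanelObs.score_ofErrors_symm M.θ₀ x₁ x₂ α e₁ e₂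
        simp only [PanelObs.dx_ofErrors]
        linear_combination (inner ℝ (x₁ - x₂) u : ℝ) * hs
    rw [integral_zero] at this
    exact this
  have hidx : ∀ ω, (M.obs ω).index θ - (M.obs ω).index M.θ₀ = inner ℝ (M.dX ω) u := fun ω =>
    PanelObs.index_sub _ _ _
  have hρ0 : ∀ ω, 0 ≤ (M.obs ω).loss θ - (M.obs ω).loss M.θ₀ -
      (M.obs ω).score M.θ₀ * inner ℝ (M.dX ω) u := fun ω => by
    have : (M.obs ω).loss M.θ₀ + (M.obs ω).score M.θ₀ *
        ((M.obs ω).index θ - (M.obs ω).index M.θ₀) ≤ (M.obs ω).loss θ :=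
      tlsLoss_tangent_le _ _ (M.y₁_obs_nonneg ω) (M.y₂_obs_nonneg ω)
    rw [hidx] at this
    linarith
  have hli := integrable_loss_sub hm hV θ
  have heq : ∫ ω, ((M.obs ω).loss θ - (M.obs ω).loss M.θ₀) ∂P =
      ∫ ω, ((M.obs ω).loss θ - (M.obs ω).loss M.θ₀ -
        (M.obs ω).score M.θ₀ * inner ℝ (M.dX ω) u) ∂P := by
    rw [integral_sub hli hsi, hs0, sub_zero]
  rw [heq]
  refine lt_of_le_of_ne (integral_nonneg hρ0) fun h => hθ ?_
  rw [eq_comm, integral_eq_zero_iff_of_nonneg hρ0 (hli.sub hsi)] at h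
  -- If the integral were zero, the loss would meet its tangent almost surely; strictness then
  -- forces the slope weight or the index increment to vanish.
  have hsl : (fun ω => (M.obs ω).slopeWeight M.θ₀ θ * (inner ℝ (M.dX ω) u : ℝ) ^ 2) =ᵐ[P] 0 := by
    filter_upwards [h] with ω hω
    by_contra hne
    obtain ⟨h1, h2⟩ := mul_ne_zero_iff.1 hne
    have h3 := PanelObs.loss_tangent_lt (M.y₁_obs_nonneg ω) (M.y₂_obs_nonneg ω) h1
      (sub_ne_zero.1 (by rw [hidx]; exact fun h => h2 (by rw [h]; norm_num)))
    rw [hidx] at h3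
    have h4 : (M.obs ω).loss θ - (M.obs ω).loss M.θ₀ -
      (M.obs ω).score M.θ₀ * inner ℝ (M.dX ω) u = 0 := hω
    linarith
  have hq := (measurable_inner_sq u).comp (PanelObs.measurable_dx (K := K))
  have hmid : ∫ ω, (M.obs ω).midWeight M.θ₀ * (inner ℝ (M.dX ω) u : ℝ) ^ 2 ∂P = 0 := by
    have hsl0 := integral_congr_ae hsl
    simp only [Pi.zero_apply, integral_zero] at hsl0
    rw [← hsl0]
    refine integral_obs_eq_of_symm he
      (f := fun z => z.midWeight M.θ₀ * (inner ℝ z.dx u : ℝ) ^ 2)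
      (g := fun z => z.slopeWeight M.θ₀ θ * (inner ℝ z.dx u : ℝ) ^ 2)
      ((PanelObs.measurable_midWeight _).mul hq) ((PanelObs.measurable_slopeWeight _ _).mul hq)
      (integrable_weight_mul hm (measurable_midWeight _)
        (fun ω => abs_midWeight_le_one _ _) (measurable_inner_sq u) (abs_inner_sq_le u))
      (integrable_weight_mul hm (measurable_slopeWeight _ _)
        (fun ω => abs_slopeWeight_le_one _ _ _) (measurable_inner_sq u) (abs_inner_sq_le u))
      fun x₁ x₂ α e₁ e₂ => ?_
    have hs := PanelObs.slopeWeight_ofErrors_symm M.θ₀ x₁ x₂ α e₁ e₂ θ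
    rw [← inner_sub_right, ← hu] at hs
    simp only [PanelObs.dx_ofErrors]
    linear_combination -(inner ℝ (x₁ - x₂) u : ℝ) * hs
  exact sub_eq_zero.1 (eq_zero_of_integral_midWeight hm he hj hmid)

/-- The sample is tied to the model only through its law, so the sign of the outcomes has to be
transferred. -/
theorem ae_sample_nonneg (hZ : IsRandomSample M P Z Q) :
    ∀ᵐ ω ∂Q, ∀ i, 0 ≤ (Z i ω).y₁ ∧ 0 ≤ (Z i ω).y₂ := by
  rw [ae_all_iff]
  intro i
  exact (hZ.2 i).symm.ae_snd
    (p := fun z : PanelObs K => 0 ≤ z.y₁ ∧ 0 ≤ z.y₂)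
    ((measurableSet_le measurable_const PanelObs.measurable_y₁).inter
      (measurableSet_le measurable_const PanelObs.measurable_y₂))
    (Eventually.of_forall fun ω => ⟨M.y₁_obs_nonneg ω, M.y₂_obs_nonneg ω⟩)

theorem tlsCriterion_sub (z : ℕ → PanelObs K) (n : ℕ) (θ θ' : RVec K) :
    tlsCriterion z n θ - tlsCriterion z n θ' =
      (n : ℝ)⁻¹ * ∑ i ∈ Finset.range n, ((z i).loss θ - (z i).loss θ') := by
  rw [tlsCriterion, tlsCriterion, Finset.sum_sub_distrib, mul_sub]

theorem abs_average_le {f g : ℕ → ℝ} (h : ∀ i, |f i| ≤ g i) (n : ℕ) :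
    |(n : ℝ)⁻¹ * ∑ i ∈ Finset.range n, f i| ≤ (n : ℝ)⁻¹ * ∑ i ∈ Finset.range n, g i := by
  rw [abs_mul, abs_of_nonneg (by positivity : (0 : ℝ) ≤ (n : ℝ)⁻¹)]
  gcongr
  exact (Finset.abs_sum_le_sum_abs _ _).trans (Finset.sum_le_sum fun i _ => h i)

theorem ae_eventually_criterion_lt_on_sphere [IsProbabilityMeasure P] (hm : M.MomentConditions P)
    (hV : M.VExists P) (he : M.ExchangeableErrors P) (hj : M.JacobianRank P)
    (hZ : IsRandomSample M P Z Q) {r : ℝ} (hr : 0 < r) :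
    ∀ᵐ ω ∂Q, ∀ᶠ n in atTop, ∀ θ ∈ Metric.sphere M.θ₀ r,
      tlsCriterion (fun i => Z i ω) n M.θ₀ < tlsCriterion (fun i => Z i ω) n θ := by
  set L : RVec K → ℝ := fun θ => ∫ ω, ((M.obs ω).loss θ - (M.obs ω).loss M.θ₀) ∂P with hL
  set B : PanelObs K → ℝ := fun z => |z.score M.θ₀| * ‖z.dx‖ + r * ‖z.dx‖ ^ 2 with hB
  have hBm : Measurable B := ((PanelObs.measurable_score _).abs.mul
    PanelObs.measurable_dx.norm).add ((PanelObs.measurable_dx.norm.pow_const 2).const_mul r)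
  have hBi : Integrable (fun ω => B (M.obs ω)) P := integrable_lossBound hm hV r
  -- Adding one makes `b` positive and strictly larger than the mean, so the sample averages of `B`
  -- are eventually below it.
  set b : ℝ := (∫ ω, B (M.obs ω) ∂P) + 1 with hb
  have hB0 : ∀ z, 0 ≤ B z := fun z => by positivity
  have hbpos : 0 < b := add_pos_of_nonneg_of_pos (integral_nonneg fun ω => hB0 _) one_pos
  have hpos : ∀ θ ∈ Metric.sphere M.θ₀ r, 0 < L θ := fun θ hθ =>
    integral_loss_sub_pos hm hV he hj (Metric.ne_of_mem_sphere hθ hr.ne')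
  -- The radii are chosen so that moving from a centre `τ` changes the criterion by at most `L τ /
  -- 4`, while the law of large numbers yields an excess above `L τ / 2` at `τ`.
  obtain ⟨T, hT, hTcov⟩ := (isCompact_sphere M.θ₀ r).elim_nhds_subcover
    (fun θ => Metric.ball θ (L θ / (4 * b)))
    (fun θ hθ => Metric.ball_mem_nhds _ (div_pos (hpos θ hθ) (by positivity)))
  have hlln : ∀ᵐ ω ∂Q, ∀ τ ∈ T, Tendsto (fun n : ℕ => (n : ℝ)⁻¹ * ∑ i ∈ Finset.range n,
      ((Z i ω).loss τ - (Z i ω).loss M.θ₀)) atTop (𝓝 (L τ)) :=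
    (ae_ball_iff T.countable_toSet).2 fun τ _ => ae_tendsto_average hZ.1 hZ.2
      (f := fun z => z.loss τ - z.loss M.θ₀)
      ((PanelObs.measurable_loss τ).sub (PanelObs.measurable_loss M.θ₀))
      (integrable_loss_sub hm hV τ)
  filter_upwards [hlln, ae_tendsto_average hZ.1 hZ.2 hBm hBi, ae_sample_nonneg hZ]
    with ω h1 h2 h3
  have e1 : ∀ᶠ n : ℕ in atTop, ∀ τ ∈ T, L τ / 2 < (n : ℝ)⁻¹ * ∑ i ∈ Finset.range n,
      ((Z i ω).loss τ - (Z i ω).loss M.θ₀) := by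
    rw [eventually_all_finset]
    intro τ hτ
    exact (h1 τ hτ).eventually_const_lt (by linarith [hpos τ (hT τ hτ)])
  filter_upwards [e1, h2.eventually_lt_const (show _ < b by rw [hb]; linarith)] with n k1 k2 θ hθ
  obtain ⟨τ, hτ, hθτ⟩ := Set.mem_iUnion₂.1 (hTcov hθ)
  have hLτ := hpos τ (hT τ hτ)
  have hclose : |(n : ℝ)⁻¹ * ∑ i ∈ Finset.range n, ((Z i ω).loss θ - (Z i ω).loss τ)| ≤
      (n : ℝ)⁻¹ * ∑ i ∈ Finset.range n, ‖θ - τ‖ * B (Z i ω) :=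
    abs_average_le (fun i => PanelObs.abs_loss_sub_le (h3 i).1 (h3 i).2
      (mem_sphere_iff_norm.1 hθ).le (mem_sphere_iff_norm.1 (hT τ hτ)).le) n
  rw [← Finset.mul_sum, mul_left_comm, ← tlsCriterion_sub (fun i => Z i ω)] at hclose
  have hnorm : ‖θ - τ‖ ≤ L τ / (4 * b) := (mem_ball_iff_norm.1 hθτ).le
  have hsmall : ‖θ - τ‖ * ((n : ℝ)⁻¹ * ∑ i ∈ Finset.range n, B (Z i ω)) ≤ L τ / (4 * b) * b := by
    have : 0 ≤ (n : ℝ)⁻¹ * ∑ i ∈ Finset.range n, B (Z i ω) :=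
      mul_nonneg (by positivity) (Finset.sum_nonneg fun i _ => hB0 _)
    gcongr
  have hcancel : L τ / (4 * b) * b = L τ / 4 := by field_simp
  have k3 := k1 τ hτ
  rw [← tlsCriterion_sub (fun i => Z i ω)] at k3
  have := (abs_le.1 (hclose.trans hsmall)).1
  linarith

theorem tlsCriterion_convex {z : ℕ → PanelObs K} (hz : ∀ i, 0 ≤ (z i).y₁ ∧ 0 ≤ (z i).y₂) (n : ℕ)
    (θ θ₀ : RVec K) {l : ℝ} (hl : 0 ≤ l) (hl' : l ≤ 1) :
    tlsCriterion z n (θ₀ + l • (θ - θ₀)) ≤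
      (1 - l) * tlsCriterion z n θ₀ + l * tlsCriterion z n θ := by
  have h : ∀ i, (z i).loss (θ₀ + l • (θ - θ₀)) ≤ (1 - l) * (z i).loss θ₀ + l * (z i).loss θ :=
    fun i => by
      have he : (z i).index (θ₀ + l • (θ - θ₀)) =
          (z i).index θ₀ + l * ((z i).index θ - (z i).index θ₀) := by
        rw [PanelObs.index_sub]
        simp only [PanelObs.index, inner_add_right, real_inner_smul_right]
      unfold PanelObs.loss
      rw [he]
      exact tlsLoss_convex _ _ (hz i).1 (hz i).2 hl hl'
  unfold tlsCriterion
  calc _ ≤ (n : ℝ)⁻¹ * ∑ i ∈ Finset.range n, ((1 - l) * (z i).loss θ₀ + l * (z i).loss θ) := by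
        gcongr
        exact h _
    _ = _ := by
        rw [Finset.sum_add_distrib, ← Finset.mul_sum, ← Finset.mul_sum]
        ring

/-- Strong consistency of the trimmed least squares estimator. -/
theorem ae_tendsto_estimator [IsProbabilityMeasure P] (hm : M.MomentConditions P)
    (hV : M.VExists P) (he : M.ExchangeableErrors P) (hj : M.JacobianRank P)
    (hZ : IsRandomSample M P Z Q) {θhat : ℕ → Ω' → RVec K} (hθ : IsTLSEstimator Z Q θhat) :
    ∀ᵐ ω ∂Q, Tendsto (fun n => θhat n ω) atTop (𝓝 M.θ₀) := by
  have hall : ∀ᵐ ω ∂Q, ∀ k : ℕ, ∀ᶠ n in atTop, ∀ θ ∈ Metric.sphere M.θ₀ (1 / ((k : ℝ) + 1)),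
      tlsCriterion (fun i => Z i ω) n M.θ₀ < tlsCriterion (fun i => Z i ω) n θ :=
    ae_all_iff.2 fun k =>
      ae_eventually_criterion_lt_on_sphere hm hV he hj hZ Nat.one_div_pos_of_nat
  filter_upwards [hall, hθ, ae_sample_nonneg hZ] with ω h1 h2 h3
  rw [Metric.tendsto_nhds]
  intro ε hε
  obtain ⟨k, hk⟩ := exists_nat_one_div_lt hε
  filter_upwards [h1 k, eventually_ge_atTop 1] with n hn hn1
  by_contra hfar
  set r : ℝ := 1 / ((k : ℝ) + 1) with hr
  have hr0 : 0 < r := Nat.one_div_pos_of_nat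
  set D := ‖θhat n ω - M.θ₀‖ with hD
  have hDr : r < D := by
    rw [dist_eq_norm, not_lt] at hfar
    exact hk.trans_le hfar
  have hD0 : 0 < D := hr0.trans hDr
  -- A minimizer outside the sphere is pulled back along the segment to `θ₀`. By convexity the
  -- criterion at the crossing point is at most its value at `θ₀`, contradicting the strict
  -- inequality on the sphere.
  have hmem : M.θ₀ + (r / D) • (θhat n ω - M.θ₀) ∈ Metric.sphere M.θ₀ r := by
    rw [mem_sphere_iff_norm, add_sub_cancel_left, norm_smul, Real.norm_of_nonneg (by positivity)]
    exact div_mul_cancel₀ _ hD0.ne'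
  have a := hn _ hmem
  have b := tlsCriterion_convex h3 n (θhat n ω) M.θ₀ (l := r / D) (by positivity)
    ((div_le_one hD0).2 hDr.le)
  have c := h2 n hn1 M.θ₀
  have d : 0 ≤ r / D := by positivity
  nlinarith

/-! ### Consistency of the outer-product estimator -/

/-- A difference of squares factors into two terms controlled by the Lipschitz bound. Replacing the
estimator by `θ₀` thus costs averages with finite limits times powers of the estimation error. -/
theorem ae_tendsto_tlsVHat [IsProbabilityMeasure P] (hm : M.MomentConditions P)
    (hV : M.VExists P) (he : M.ExchangeableErrors P) (hj : M.JacobianRank P)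
    (hZ : IsRandomSample M P Z Q) {θhat : ℕ → Ω' → RVec K} (hθ : IsTLSEstimator Z Q θhat) :
    ∀ᵐ ω ∂Q, Tendsto (fun n => tlsVHat (fun i => Z i ω) n (θhat n ω)) atTop (𝓝 (M.V₀ P)) := by
  have hlln : ∀ᵐ ω ∂Q, ∀ j k, Tendsto (fun n : ℕ => (n : ℝ)⁻¹ * ∑ i ∈ Finset.range n,
      ((Z i ω).score M.θ₀ ^ 2 * outer (Z i ω).dx j k)) atTop (𝓝 (M.V₀ P j k)) :=
    ae_all_iff.2 fun j => ae_all_iff.2 fun k => ae_tendsto_average hZ.1 hZ.2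
      (f := fun z => z.score M.θ₀ ^ 2 * outer z.dx j k)
      (((PanelObs.measurable_score _).pow_const 2).mul
        ((measurable_outer j k).comp PanelObs.measurable_dx)) (hV j k)
  have hlln3 := ae_tendsto_average hZ.1 hZ.2 (f := fun z => |z.score M.θ₀| * ‖z.dx‖ ^ 3)
    ((PanelObs.measurable_score _).abs.mul (PanelObs.measurable_dx.norm.pow_const 3))
    (integrable_abs_score_mul_cube hm hV)
  have hlln4 := ae_tendsto_average hZ.1 hZ.2 (f := fun z => ‖z.dx‖ ^ 4)
    (PanelObs.measurable_dx.norm.pow_const 4) (integrable_norm_dX_pow_four hm)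
  filter_upwards [hlln, hlln3, hlln4, ae_sample_nonneg hZ, ae_tendsto_estimator hm hV he hj hZ hθ]
    with ω h1 h3 h4 h0 hθω
  refine tendsto_pi_nhds.2 fun j => tendsto_pi_nhds.2 fun k => ?_
  have hd : Tendsto (fun n => ‖θhat n ω - M.θ₀‖) atTop (𝓝 0) :=
    tendsto_iff_norm_sub_tendsto_zero.1 hθω
  have hpoint : ∀ n i, |(Z i ω).score (θhat n ω) ^ 2 * outer (Z i ω).dx j k -
      (Z i ω).score M.θ₀ ^ 2 * outer (Z i ω).dx j k| ≤
      2 * ‖θhat n ω - M.θ₀‖ * (|(Z i ω).score M.θ₀| * ‖(Z i ω).dx‖ ^ 3) +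
        ‖θhat n ω - M.θ₀‖ ^ 2 * ‖(Z i ω).dx‖ ^ 4 := fun n i => by
    have hL := PanelObs.abs_score_sub_le (h0 i).1 (h0 i).2 (θhat n ω) M.θ₀
    set s := (Z i ω).score (θhat n ω)
    set s₀ := (Z i ω).score M.θ₀
    set N := ‖(Z i ω).dx‖
    set d := ‖θhat n ω - M.θ₀‖
    have hplus : |s + s₀| ≤ N * d + 2 * |s₀| := by
      have : s + s₀ = (s - s₀) + 2 * s₀ := by ring
      rw [this]
      refine (abs_add_le _ _).trans ?_
      rw [abs_mul, abs_two]
      linarith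
    have hfac : s ^ 2 * outer (Z i ω).dx j k - s₀ ^ 2 * outer (Z i ω).dx j k =
        (s - s₀) * (s + s₀) * outer (Z i ω).dx j k := by ring
    rw [hfac, abs_mul, abs_mul]
    calc _ ≤ (N * d) * (N * d + 2 * |s₀|) * N ^ 2 := by
          gcongr
          exact abs_outer_le _ j k
      _ = _ := by ring
  have hzero : Tendsto (fun n : ℕ => (n : ℝ)⁻¹ * ∑ i ∈ Finset.range n,
      ((Z i ω).score (θhat n ω) ^ 2 * outer (Z i ω).dx j k -
        (Z i ω).score M.θ₀ ^ 2 * outer (Z i ω).dx j k)) atTop (𝓝 0) := by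
    have hup := ((hd.const_mul 2).mul h3).add ((hd.pow 2).mul h4)
    simp only [mul_zero, zero_mul, zero_pow two_ne_zero, add_zero] at hup
    refine squeeze_zero_norm (fun n => ?_) hup
    refine (abs_average_le (hpoint n) n).trans (le_of_eq ?_)
    rw [Finset.sum_add_distrib, ← Finset.mul_sum, ← Finset.mul_sum]
    ring
  have hsum := hzero.add (h1 j k)
  rw [zero_add] at hsum
  refine hsum.congr fun n => ?_
  rw [← mul_add, ← Finset.sum_add_distrib]
  simp only [sub_add_cancel]
  simp [tlsVHat, Matrix.sum_apply]

end CensoredPanel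

/-! ### Pointwise dependence of the midpoint weight on the parameter -/

namespace PanelObs

variable {K : ℕ}

/-- With equal true indices, swapping the errors swaps which outcomes are positive. The weights on
the two indicators always add to one, and the value one half on ties preserves this, so the sum is
the same for every `θ`. -/
theorem midWeight_ofErrors_symm (θ₀ x₁ x₂ : RVec K) (α e₁ e₂ : ℝ) (θ : RVec K)
    (h : (inner ℝ x₁ θ₀ : ℝ) = inner ℝ x₂ θ₀) :
    midWeight (ofErrors θ₀ x₁ x₂ α e₁ e₂) θ + midWeight (ofErrors θ₀ x₁ x₂ α e₂ e₁) θ =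
      midWeight (ofErrors θ₀ x₁ x₂ α e₁ e₂) θ₀ + midWeight (ofErrors θ₀ x₁ x₂ α e₂ e₁) θ₀ := by
  unfold midWeight ind
  simp only [index_ofErrors_self, y₁_ofErrors, y₂_ofErrors, index_ofErrors, lt_max_iff, lt_irrefl,
    false_or]
  generalize (inner ℝ x₁ θ₀ : ℝ) = a at h ⊢
  generalize (inner ℝ x₂ θ₀ : ℝ) = b at h ⊢
  rcases lt_trichotomy (inner ℝ (x₁ - x₂) θ : ℝ) 0 with ht | ht | ht
  · grind
  · grind
  · grind

/-- The midpoint convention makes the weight a constant plus an odd function of the index, so only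
the open half-spaces of `θ` and `-θ` occur. -/
theorem midWeight_mul_eq (z : PanelObs K) (θ : RVec K) (c : ℝ) :
    midWeight z θ * c = (ind (0 < y₁ z) + ind (0 < y₂ z)) / 2 * c +
      ((if 0 < (inner ℝ (dx z) θ : ℝ) then (ind (0 < y₂ z) - ind (0 < y₁ z)) / 2 * c else 0) -
        if 0 < (inner ℝ (dx z) (-θ) : ℝ) then
          (ind (0 < y₂ z) - ind (0 < y₁ z)) / 2 * c else 0) := by
  rw [inner_neg_right]
  unfold midWeight index
  generalize (inner ℝ (dx z) θ : ℝ) = t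
  rcases lt_trichotomy t 0 with h | h | h
  · simp only [ind, h, h.ne, h.not_gt, neg_pos, if_true, if_false]; ring
  · subst h; simp only [ind, lt_irrefl, neg_zero, if_true, if_false]; ring
  · simp only [ind, h, h.ne', h.not_gt, neg_pos, if_true, if_false]; ring

theorem eventually_midWeight_eq {z : PanelObs K} {θ₀ : RVec K} (h : index z θ₀ ≠ 0) :
    ∀ᶠ θ in 𝓝 θ₀, midWeight z θ = midWeight z θ₀ := by
  have hc : Tendsto (fun θ => index z θ) (𝓝 θ₀) (𝓝 (index z θ₀)) :=
    (by unfold index; fun_prop : Continuous fun θ => index z θ).tendsto θ₀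
  unfold midWeight
  rcases lt_or_gt_of_ne h with h | h
  · filter_upwards [hc.eventually_lt_const h] with θ hθ
    simp only [ind, h, h.ne, h.not_gt, hθ, hθ.ne, hθ.not_gt]
  · filter_upwards [hc.eventually_const_lt h] with θ hθ
    simp only [ind, h, h.ne', h.not_gt, hθ, hθ.ne', hθ.not_gt]

end PanelObs

namespace CensoredPanel

variable {K : ℕ} {Ω Ω' : Type*} [MeasurableSpace Ω] [MeasurableSpace Ω'] {M : CensoredPanel K Ω}
  {P : Measure Ω} {Q : Measure Ω'} {Z : ℕ → Ω' → PanelObs K}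

/-! ### Consistency of the Hessian estimator -/

theorem ae_uniform_average_midWeight [IsProbabilityMeasure P] (hm : M.MomentConditions P)
    (hZ : IsRandomSample M P Z Q) (j k : Fin K) {ε : ℝ} (hε : 0 < ε) :
    ∀ᵐ ω ∂Q, ∀ᶠ n : ℕ in atTop, ∀ θ : RVec K,
      |(n : ℝ)⁻¹ * ∑ i ∈ Finset.range n, (Z i ω).midWeight θ * outer (Z i ω).dx j k -
        ∫ ω, (M.obs ω).midWeight θ * outer (M.dX ω) j k ∂P| ≤ ε := by
  have m1 : Measurable fun z : PanelObs K => ind (0 < z.y₁) :=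
    Measurable.ind (measurableSet_lt measurable_const PanelObs.measurable_y₁)
  have m2 : Measurable fun z : PanelObs K => ind (0 < z.y₂) :=
    Measurable.ind (measurableSet_lt measurable_const PanelObs.measurable_y₂)
  have mo : Measurable fun z : PanelObs K => outer z.dx j k :=
    (measurable_outer j k).comp PanelObs.measurable_dx
  set a : PanelObs K → ℝ := fun z => (ind (0 < z.y₂) - ind (0 < z.y₁)) / 2 * outer z.dx j k with ha
  set c : PanelObs K → ℝ := fun z => (ind (0 < z.y₁) + ind (0 < z.y₂)) / 2 * outer z.dx j k with hc
  have ham : Measurable a := ((m2.sub m1).div_const 2).mul mo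
  have hcm : Measurable c := ((m1.add m2).div_const 2).mul mo
  have hq : ∀ v : RVec K, |outer v j k| ≤ 1 * ‖v‖ ^ 2 := fun v => by
    rw [one_mul]; exact abs_outer_le v j k
  have hai : Integrable (fun ω => a (M.obs ω)) P := by
    refine integrable_weight_mul hm (((m2.sub m1).div_const 2).comp M.measurable_obs)
      (fun ω => ?_) (measurable_outer j k) hq
    simp only [Function.comp, Pi.sub_apply]
    rw [abs_le]
    constructor <;> linarith [ind_nonneg (0 < (M.obs ω).y₁), ind_nonneg (0 < (M.obs ω).y₂),
      ind_le_one (0 < (M.obs ω).y₁), ind_le_one (0 < (M.obs ω).y₂)]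
  have hci : Integrable (fun ω => c (M.obs ω)) P := by
    refine integrable_weight_mul hm (((m1.add m2).div_const 2).comp M.measurable_obs)
      (fun ω => ?_) (measurable_outer j k) hq
    simp only [Function.comp, Pi.add_apply]
    rw [abs_le]
    constructor <;> linarith [ind_nonneg (0 < (M.obs ω).y₁), ind_nonneg (0 < (M.obs ω).y₂),
      ind_le_one (0 < (M.obs ω).y₁), ind_le_one (0 < (M.obs ω).y₂)]
  have hdec : ∀ (θ : RVec K) (z : PanelObs K), z.midWeight θ * outer z.dx j k =
      c z + (Set.indicator {z | 0 < (inner ℝ z.dx θ : ℝ)} a z -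
        Set.indicator {z | 0 < (inner ℝ z.dx (-θ) : ℝ)} a z) := fun θ z => by
    rw [PanelObs.midWeight_mul_eq]
    simp only [Set.indicator, Set.mem_ofPred_eq, ha, hc]
  have hind : ∀ θ : RVec K, Integrable
      (fun ω => Set.indicator {z : PanelObs K | 0 < (inner ℝ z.dx θ : ℝ)} a (M.obs ω)) P :=
    fun θ => hai.indicator (s := M.obs ⁻¹' {z : PanelObs K | 0 < (inner ℝ z.dx θ : ℝ)})
      (M.measurable_obs (measurableSet_lt measurable_const PanelObs.measurable_dx.inner_const))
  filter_upwards [ae_uniform_average_halfspace hZ.1 hZ.2 M.measurable_obs ham hai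
      PanelObs.measurable_dx (by positivity : 0 < ε / 3),
    ae_tendsto_average hZ.1 hZ.2 hcm hci] with ω h1 h2
  filter_upwards [h1, (Metric.tendsto_nhds.1 h2) (ε / 3) (by positivity)] with n k1 k2 θ
  have e1 : ∫ ω, (M.obs ω).midWeight θ * outer (M.dX ω) j k ∂P = (∫ ω, c (M.obs ω) ∂P) +
      ((∫ ω, Set.indicator {z | 0 < (inner ℝ z.dx θ : ℝ)} a (M.obs ω) ∂P) -
        ∫ ω, Set.indicator {z | 0 < (inner ℝ z.dx (-θ) : ℝ)} a (M.obs ω) ∂P) := by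
    have hsub : Integrable (fun ω =>
        Set.indicator {z : PanelObs K | 0 < (inner ℝ z.dx θ : ℝ)} a (M.obs ω) -
        Set.indicator {z : PanelObs K | 0 < (inner ℝ z.dx (-θ) : ℝ)} a (M.obs ω)) P :=
      (hind θ).sub (hind (-θ))
    rw [← integral_sub (hind θ) (hind (-θ)), ← integral_add hci hsub]
    exact integral_congr_ae (Eventually.of_forall fun ω => hdec θ (M.obs ω))
  simp only [hdec]
  rw [e1, Finset.sum_add_distrib, Finset.sum_sub_distrib, mul_add, mul_sub]
  rw [Real.dist_eq, abs_lt] at k2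
  have k3 := abs_le.1 (k1 θ)
  have k4 := abs_le.1 (k1 (-θ))
  rw [abs_le]
  constructor <;> linarith [k2.1, k2.2, k3.1, k3.2, k4.1, k4.2]

/-- The integrand can jump at `θ₀` only where the true index is zero, and there symmetrization makes
the expectation constant in `θ`. -/
theorem tendsto_integral_midWeight [IsProbabilityMeasure P] (hm : M.MomentConditions P)
    (he : M.ExchangeableErrors P) (j k : Fin K) :
    Tendsto (fun θ => ∫ ω, (M.obs ω).midWeight θ * outer (M.dX ω) j k ∂P) (𝓝 M.θ₀)
      (𝓝 (∫ ω, (M.obs ω).midWeight M.θ₀ * outer (M.dX ω) j k ∂P)) := by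
  -- Freezing the weight on that event leaves the expectation unchanged and makes the integrand
  -- eventually constant near `θ₀`.
  set ψ : RVec K → PanelObs K → ℝ := fun θ z =>
    if z.index M.θ₀ = 0 then z.midWeight M.θ₀ else z.midWeight θ with hψ
  have hψm : ∀ θ, Measurable (ψ θ) := fun θ =>
    Measurable.ite (measurableSet_eq_fun (PanelObs.measurable_index _) measurable_const)
      (PanelObs.measurable_midWeight _) (PanelObs.measurable_midWeight _)
  have hψ1 : ∀ θ z, |ψ θ z| ≤ 1 := fun θ z => by
    simp only [hψ]
    split_ifs <;> exact abs_midWeight_le_one _ _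
  have mo : Measurable fun z : PanelObs K => outer z.dx j k :=
    (measurable_outer j k).comp PanelObs.measurable_dx
  have heq : ∀ θ, ∫ ω, (M.obs ω).midWeight θ * outer (M.dX ω) j k ∂P =
      ∫ ω, ψ θ (M.obs ω) * outer (M.dX ω) j k ∂P := fun θ => by
    refine integral_obs_eq_of_symm he (f := fun z => z.midWeight θ * outer z.dx j k)
      (g := fun z => ψ θ z * outer z.dx j k)
      ((PanelObs.measurable_midWeight θ).mul mo) ((hψm θ).mul mo)
      (integrable_midWeight_mul_outer hm θ j k)
      (integrable_weight_mul hm ((hψm θ).comp M.measurable_obs) (fun ω => hψ1 _ _)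
        (measurable_outer j k) (c := 1) fun v => by rw [one_mul]; exact abs_outer_le v j k)
      fun x₁ x₂ α e₁ e₂ => ?_
    simp only [hψ, PanelObs.dx_ofErrors, PanelObs.index_ofErrors_self, sub_eq_zero]
    split_ifs with h
    · linear_combination outer (x₁ - x₂) j k *
        PanelObs.midWeight_ofErrors_symm M.θ₀ x₁ x₂ α e₁ e₂ θ h
    · rfl
  simp only [heq]
  refine tendsto_integral_filter_of_dominated_convergence (fun ω => ‖M.dX ω‖ ^ 2)
    (Eventually.of_forall fun θ => (((hψm θ).comp M.measurable_obs).mul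
      ((measurable_outer j k).comp M.measurable_dX)).aestronglyMeasurable)
    (Eventually.of_forall fun θ => Eventually.of_forall fun ω => ?_)
    (integrable_norm_dX_sq hm) (Eventually.of_forall fun ω => ?_)
  · rw [Real.norm_eq_abs, abs_mul]
    exact (mul_le_of_le_one_left (abs_nonneg _) (hψ1 _ _)).trans (abs_outer_le _ j k)
  · refine tendsto_const_nhds.congr' ?_
    by_cases h : (M.obs ω).index M.θ₀ = 0
    · exact Eventually.of_forall fun θ => by simp only [hψ, h, if_true]
    · filter_upwards [PanelObs.eventually_midWeight_eq h] with θ hθ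
      simp only [hψ, h, if_false, hθ]

/-- The uniform law handles evaluation at a random parameter; continuity of the population matrix at
`θ₀` and strong consistency handle its limit. Tolerances `1 / (m + 1)` keep the almost sure events
countable. -/
theorem ae_tendsto_tlsJHat [IsProbabilityMeasure P] (hm : M.MomentConditions P)
    (hV : M.VExists P) (hc : M.ContinuousErrors P) (he : M.ExchangeableErrors P)
    (hj : M.JacobianRank P) (hZ : IsRandomSample M P Z Q) {θhat : ℕ → Ω' → RVec K}
    (hθ : IsTLSEstimator Z Q θhat) :
    ∀ᵐ ω ∂Q, Tendsto (fun n => tlsJHat (fun i => Z i ω) n (θhat n ω)) atTop (𝓝 (M.J₀ P)) := by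
  have hunif : ∀ᵐ ω ∂Q, ∀ (j k : Fin K) (m : ℕ), ∀ᶠ n : ℕ in atTop, ∀ θ : RVec K,
      |(n : ℝ)⁻¹ * ∑ i ∈ Finset.range n, (Z i ω).midWeight θ * outer (Z i ω).dx j k -
        ∫ ω, (M.obs ω).midWeight θ * outer (M.dX ω) j k ∂P| ≤ 1 / ((m : ℝ) + 1) :=
    ae_all_iff.2 fun j => ae_all_iff.2 fun k => ae_all_iff.2 fun m =>
      ae_uniform_average_midWeight hm hZ j k Nat.one_div_pos_of_nat
  filter_upwards [hunif, ae_tendsto_estimator hm hV he hj hZ hθ] with ω h1 hθω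
  refine tendsto_pi_nhds.2 fun j => tendsto_pi_nhds.2 fun k => ?_
  have hpop := (tendsto_integral_midWeight hm he j k).comp hθω
  rw [← J₀_apply hm hV hc he] at hpop
  have hdiff : Tendsto (fun n : ℕ => (n : ℝ)⁻¹ * ∑ i ∈ Finset.range n,
      (Z i ω).midWeight (θhat n ω) * outer (Z i ω).dx j k -
        ∫ ω', (M.obs ω').midWeight (θhat n ω) * outer (M.dX ω') j k ∂P) atTop (𝓝 0) := by
    rw [Metric.tendsto_nhds]
    intro ε hε
    obtain ⟨m, hm'⟩ := exists_nat_one_div_lt hε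
    filter_upwards [h1 j k m] with n hn
    rw [Real.dist_0_eq_abs]
    exact (hn _).trans_lt hm'
  have hsum := hdiff.add hpop
  rw [zero_add] at hsum
  refine hsum.congr fun n => ?_
  simp only [Function.comp, sub_add_cancel]
  simp [tlsJHat, Matrix.sum_apply]

end CensoredPanel

/-! ### Assembly: continuity of the determinant and of inversion at an invertible limit -/

theorem theorem3 {K : ℕ}
    {Ω : Type*} [MeasurableSpace Ω] (P : Measure Ω) [IsProbabilityMeasure P]
    (M : CensoredPanel K Ω)
    (h_nondeg : M.NonDegenerate P)
    (h_mom : M.MomentConditions P)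
    (h_cont : M.ContinuousErrors P)
    (h_exch : M.ExchangeableErrors P)
    (h_rank : M.RankRegressors P)
    (h_jac : M.JacobianRank P)
    (hV_exists : M.VExists P)
    (hV_rank : (M.V₀ P).rank = K)
    {Ω' : Type*} [MeasurableSpace Ω'] (Q : Measure Ω') [IsProbabilityMeasure Q]
    (Z : ℕ → Ω' → PanelObs K) (hZ : IsRandomSample M P Z Q)
    (θhat : ℕ → Ω' → RVec K) (hθ : IsTLSEstimator Z Q θhat) :
    -- the expected score is well defined and differentiable at `θ₀`, so that `J₀` is meaningful
    (∀ θ, Integrable (fun ω => (M.obs ω).score θ • M.dX ω) P) ∧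
    DifferentiableAt ℝ (M.G P) M.θ₀ ∧
    -- strong consistency of the two plug-in estimators
    (∀ᵐ ω ∂Q, Tendsto (fun n => tlsVHat (fun i => Z i ω) n (θhat n ω)) atTop (𝓝 (M.V₀ P))) ∧
    (∀ᵐ ω ∂Q, Tendsto (fun n => tlsJHat (fun i => Z i ω) n (θhat n ω)) atTop (𝓝 (M.J₀ P))) ∧
    -- strong consistency of the sandwich estimator, whose inverses are genuine in the limit
    IsUnit (M.J₀ P).det ∧
    (∀ᵐ ω ∂Q, ∀ᶠ n in atTop, IsUnit (tlsJHat (fun i => Z i ω) n (θhat n ω)).det) ∧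
    (∀ᵐ ω ∂Q, Tendsto
      (fun n => (tlsJHat (fun i => Z i ω) n (θhat n ω))⁻¹ *
        tlsVHat (fun i => Z i ω) n (θhat n ω) *
        (tlsJHat (fun i => Z i ω) n (θhat n ω))⁻¹)
      atTop (𝓝 ((M.J₀ P)⁻¹ * M.V₀ P * (M.J₀ P)⁻¹))) := by
  have hVhat := CensoredPanel.ae_tendsto_tlsVHat h_mom hV_exists h_exch h_jac hZ hθ
  have hJhat := CensoredPanel.ae_tendsto_tlsJHat h_mom hV_exists h_cont h_exch h_jac hZ hθ
  have hJ := CensoredPanel.isUnit_det_J₀ h_mom hV_exists h_cont h_exch h_jac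
  refine ⟨CensoredPanel.integrable_score_smul h_mom hV_exists,
    (CensoredPanel.hasFDerivAt_G h_mom hV_exists h_cont h_exch).differentiableAt,
    hVhat, hJhat, hJ, ?_, ?_⟩
  · filter_upwards [hJhat] with ω hω
    have hdet := ((continuous_id.matrix_det).tendsto (M.J₀ P)).comp hω
    filter_upwards [hdet.eventually_ne hJ.ne_zero] with n hn
    exact isUnit_iff_ne_zero.2 hn
  · filter_upwards [hVhat, hJhat] with ω hv hj
    have hinv : ContinuousAt Inv.inv (M.J₀ P) :=
      continuousAt_matrix_inv _ (by
        rw [Ring.inverse_eq_inv']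
        exact continuousAt_inv₀ hJ.ne_zero)
    have hj' := hinv.tendsto.comp hj
    exact (hj'.mul hv).mul hj'
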